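/- **Setting.** Fix an integer $q\ge 2$. A (generalized) Pólya urn with $q$ colours is given by activities $a_1,\dots,a_q\ge 0$, random replacement vectors $\xi_i=(\xi_{i1},\dots,\xi_{iq})$ in $\mathbb R^q$ ($1\le i\le q$), and a nonrandom initial state $X_0\in\mathbb R^q$. The urn process $(X_n)_{n\ge0}$ in $\mathbb R^q$ evolves as follows: given $X_0,\dots,X_n$, a colour $i$ is drawn with probability $a_iX_{ni}/\sum_j a_jX_{nj}$, and then $X_{n+1}=X_n+\Delta X_n$, where $\Delta X_n$ has the same distribution as $\xi_i$ and is independent of everything that has happened so far. The urn is *tenable* if for every $n\ge 0$, almost surely, $X_{ni}\ge 0$ for all $i$ and $\sum_i a_iX_{ni}>0$. It is *balanced* if there is a constant $b>0$ such that $\sum_j a_j\xi_{ij}=b$ almost surely, for every $i$. The *intensity matrix* is the $q\times q$ matrix $A$ with entries $A_{ij}=a_j\,\mathbb E\,\xi_{ji}$. For an eigenvalue $\lambda$ of $A$, let $\nu_\lambda\ge 0$ be such that the largest Jordan block of $A$ with eigenvalue $\lambda$ has size $\nu_\lambda+1$. Let $\lambda_1,\dots,\lambda_q$ be the eigenvalues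 of $A$, repeated according to algebraic multiplicity, ordered by decreasing real part and, among those with equal real part, by decreasing $\nu_j:=\nu_{\lambda_j}$. For a random vector $Y$, let $\|Y\|_p=(\mathbb E|Y|^p)^{1/p}$ with $|\cdot|$ the Euclidean norm. **Theorem 3.1.** Assume that the Pólya urn is tenable and balanced with $\lambda_1=b$. Let $p\ge 2$ be a real number and suppose that $\mathbb E|\xi_{ij}|^p<\infty$ for all $i,j$. Then there is a constant $C_p$, depending on the urn (that is, on $q$, the activities, $X_0$ and the distributions of the $\xi_i$) and on $p$ but not on $n$, such that for every $n\ge 2$ the vector $X_n$ is integrable and $$ \|X_n-\mathbb E X_n\|_p\le \begin{cases} C_p\, n^{1/2}, & \operatorname{Re}\lambda_2<\lambda_1/2,\\ C_p\, n^{1/2}(\log n)^{\nu_2+\frac12}, & \operatorname{Re}\lambda_2=\lambda_1/2,\\ C_p\, n^{\operatorname{Re}\lambda_2/\lambda_1}(\log n)^{\nu_2}, & \operatorname{Re}\lambda_2>\lambda_1/2. \end{cases} $$ -/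

import Mathlib

open MeasureTheory ProbabilityTheory

noncomputable section

/-- The data of a generalized Pólya urn with `q` colours: the activities `a i ≥ 0`, the
distributions of the random replacement vectors (`replacement i` is the law of the vector added
to the urn when a ball of colour `i` is drawn), and the nonrandom initial state. -/
structure PolyaUrn (q : ℕ) where
  activity : Fin q → ℝ
  activity_nonneg : ∀ i, 0 ≤ activity i
  replacement : Fin q → Measure (EuclideanSpace ℝ (Fin q))
  replacement_isProbability : ∀ i, IsProbabilityMeasure (replacement i)
  initial : EuclideanSpace ℝ (Fin q)

namespace PolyaUrn

variable {q : ℕ}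

/-- The total activity `∑ i, a i * x i` of the urn in state `x`. -/
def totalActivity (U : PolyaUrn q) (x : EuclideanSpace ℝ (Fin q)) : ℝ :=
  ∑ i, U.activity i * x i

/-- The probability that the ball drawn from an urn in state `x` has colour `i`. -/
def drawProb (U : PolyaUrn q) (x : EuclideanSpace ℝ (Fin q)) (i : Fin q) : ℝ :=
  U.activity i * x i / U.totalActivity x

/-- The σ-field generated by `X 0, …, X n`. -/
abbrev history {Ω : Type*} (X : ℕ → Ω → EuclideanSpace ℝ (Fin q)) (n : ℕ) : MeasurableSpace Ω :=
  ⨆ k ≤ n, MeasurableSpace.comap (X k) inferInstance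

/-- `X` is (the sequence of states of) a Pólya urn process with data `U`: it starts in the given
initial state, and, given the past, a colour `i` is drawn with probability `drawProb (X n) i`
and then an independent vector with the distribution of the replacement vector of colour `i` is
added. In other words, the conditional law of the increment given the past is the mixture of the
replacement laws with the draw probabilities as weights. -/
structure IsUrnChain (U : PolyaUrn q) {Ω : Type*} [MeasurableSpace Ω] (P : Measure Ω)
    (X : ℕ → Ω → EuclideanSpace ℝ (Fin q)) : Prop where
  measurable : ∀ n, Measurable (X n)
  initial_eq : ∀ᵐ ω ∂P, X 0 ω = U.initial
  step : ∀ n, ∀ B : Set (EuclideanSpace ℝ (Fin q)), MeasurableSet B →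
    P⟦{ω | X (n + 1) ω - X n ω ∈ B} | history X n⟧
      =ᵐ[P] fun ω => ∑ i, U.drawProb (X n ω) i * (U.replacement i).real B

/-- Tenability: for every `n`, almost surely all coordinates of the state are nonnegative and the
total activity is positive. -/
def IsTenable (U : PolyaUrn q) {Ω : Type*} [MeasurableSpace Ω] (P : Measure Ω)
    (X : ℕ → Ω → EuclideanSpace ℝ (Fin q)) : Prop :=
  ∀ n, ∀ᵐ ω ∂P, (∀ i, 0 ≤ X n ω i) ∧ 0 < U.totalActivity (X n ω)

/-- The urn is balanced with constant `b > 0`: every replacement vector almost surely has total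
activity `b`. -/
def IsBalanced (U : PolyaUrn q) (b : ℝ) : Prop :=
  0 < b ∧ ∀ i, ∀ᵐ x ∂(U.replacement i), U.totalActivity x = b

/-- The intensity matrix, with entries `A i j = a j * E ξ_{j i}`. -/
def intensity (U : PolyaUrn q) : Matrix (Fin q) (Fin q) ℝ :=
  Matrix.of fun i j => U.activity j * ∫ x, x i ∂(U.replacement j)

/-- The intensity matrix regarded as a complex matrix. -/
def intensityC (U : PolyaUrn q) : Matrix (Fin q) (Fin q) ℂ :=
  U.intensity.map (algebraMap ℝ ℂ)

end PolyaUrn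

/-- For an eigenvalue `μ` of `A`, the least `k` such that `(A - μ) ^ (k + 1)` vanishes on the
generalized eigenspace of `μ`; equivalently, the largest Jordan block of `A` with eigenvalue `μ`
has size `k + 1`. -/
def jordanIndex {q : ℕ} (A : Matrix (Fin q) (Fin q) ℂ) (μ : ℂ) : ℕ :=
  sInf {k : ℕ | ∀ v ∈ Module.End.maxGenEigenspace (Matrix.toLin' A) μ,
    ((Matrix.toLin' A - μ • (1 : Module.End ℂ (Fin q → ℂ))) ^ (k + 1)) v = 0}

/-- `ev` lists the eigenvalues of `A`, repeated according to algebraic multiplicity, in order of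
decreasing real parts and, among equal real parts, of decreasing `jordanIndex`. -/
structure IsEigenvalueOrdering {q : ℕ} (A : Matrix (Fin q) (Fin q) ℂ) (ev : Fin q → ℂ) :
    Prop where
  roots_eq : Finset.univ.val.map ev = A.charpoly.roots
  re_antitone : ∀ j k, j ≤ k → (ev k).re ≤ (ev j).re
  index_antitone : ∀ j k, j ≤ k → (ev k).re = (ev j).re →
    jordanIndex A (ev k) ≤ jordanIndex A (ev j)

end

/-! In a balanced urn the total activity after n draws is the number w_n = w_0 + n b. Hence the
conditional mean of an increment is the linear function w_n⁻¹ A X_n of the state, and X_{n+1} = (1 +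
w_n⁻¹ A) X_n + Y_n with martingale differences Y_n that are bounded in L^p. Solving this recursion
(`eq_propagator_add_sum`) writes X_n - E X_n as the sum over l < n of F_{l+1,n} Y_l, where F_{l+1,n}
is the deterministic product of the factors 1 + w_k⁻¹ A with l < k < n. For fixed n the partial sums
form a martingale, so a Burkholder type inequality (`eLpNorm_sum_le_sqrt_of_orthogonal`) leaves only
a sum of squares of bounds for F_{l+1,n}.

These bounds are needed only on the vectors that the noise can take. By balance the activity vector
a is a left eigenvector of A with eigenvalue b, and a · Y_l = 0. If Re λ₂ < b, then λ₁ = b is simple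
and the kernel of a lies in the sum of the other generalized eigenspaces
(`ker_le_iSup_maxGenEigenspace_ne`). There the products are at most of order exp(h Re λ₂) (1 +
h)^ν₂, where h is the sum of the w_k⁻¹ and equals b⁻¹ log(w_n / w_{l+1}) up to a bounded error. The
sum of squares is thus at most of order Σ (n/l)^(2 Re λ₂ / b) (1 + log(n/l))^(2 ν₂), and the three
rates correspond to the exponent 2 Re λ₂ / b being below, at or above 1.

If Re λ₂ = b, the eigenvalue b need not be simple, but the claimed rate is then at least of order n
and the triangle inequality suffices. -/

/-! ### Elementary inequalities for p-th powers -/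

theorem rpow_sub_two_mul_sq {p a : ℝ} (hp : 2 ≤ p) (ha : 0 ≤ a) : a ^ (p - 2) * a ^ 2 = a ^ p := by
  rcases ha.eq_or_lt with rfl | ha
  · rw [Real.zero_rpow (by linarith : p ≠ 0)]; simp
  · rw [← Real.rpow_natCast a 2, ← Real.rpow_add ha]; congr 1; push_cast; ring

/-- The constant in the second order Taylor bound for `|x + y| ^ p`. -/
noncomputable def taylorConst (p : ℝ) : ℝ := (p + 1) ^ p + p ^ p + p ^ 2

theorem one_le_taylorConst {p : ℝ} (hp : 2 ≤ p) : 1 ≤ taylorConst p := by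
  have h1 : 0 ≤ (p + 1) ^ p := Real.rpow_nonneg (by linarith) _
  have h2 : 0 ≤ p ^ p := Real.rpow_nonneg (by linarith) _
  unfold taylorConst; nlinarith

/-- There are two regimes. If |x| ≤ p|y|, all terms are dominated by |y|^p: (p + 1)^p pays for the
left side and p^p for the linear term. Otherwise t = y/x satisfies |tp| ≤ 1, and (1 + t)^p ≤ exp(tp)
≤ 1 + tp + (tp)² gives the coefficient p² of the quadratic term. -/
theorem abs_add_rpow_le {p : ℝ} (hp : 2 ≤ p) (x y : ℝ) :
    |x + y| ^ p ≤ |x| ^ p + p * (|x| ^ (p - 2) * x * y)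
      + taylorConst p * (|x| ^ (p - 2) * y ^ 2 + |y| ^ p) := by
  have hp0 : 0 ≤ p := by linarith
  have h1 : 0 ≤ (p + 1) ^ p := Real.rpow_nonneg (by linarith) _
  have h2 : 0 ≤ p ^ p := Real.rpow_nonneg (by linarith) _
  have hx2 : 0 ≤ |x| ^ (p - 2) := Real.rpow_nonneg (abs_nonneg _) _
  have hyp : 0 ≤ |y| ^ p := Real.rpow_nonneg (abs_nonneg _) _
  have hxp : 0 ≤ |x| ^ p := Real.rpow_nonneg (abs_nonneg _) _
  have hA : 0 ≤ |x| ^ (p - 2) * y ^ 2 := by positivity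
  unfold taylorConst
  rcases le_or_gt |x| (p * |y|) with h | h
  · have hpy : 0 ≤ p * |y| := by positivity
    have e1 : |x + y| ^ p ≤ (p + 1) ^ p * |y| ^ p := by
      rw [← Real.mul_rpow (by linarith) (abs_nonneg _)]
      exact Real.rpow_le_rpow (abs_nonneg _) (by linarith [abs_add_le x y]) hp0
    have e2 : -(p ^ p * |y| ^ p) ≤ p * (|x| ^ (p - 2) * x * y) := by
      have e3 : |p * (|x| ^ (p - 2) * x * y)| ≤ p ^ p * |y| ^ p := by
        rw [← Real.mul_rpow hp0 (abs_nonneg _), ← rpow_sub_two_mul_sq hp hpy]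
        have e4 : |x| ^ (p - 2) ≤ (p * |y|) ^ (p - 2) :=
          Real.rpow_le_rpow (abs_nonneg _) h (by linarith)
        calc |p * (|x| ^ (p - 2) * x * y)| = |x| ^ (p - 2) * (|x| * (p * |y|)) := by
              rw [abs_mul, abs_mul, abs_mul, abs_of_nonneg hx2, abs_of_nonneg hp0]; ring
          _ ≤ (p * |y|) ^ (p - 2) * ((p * |y|) * (p * |y|)) := by gcongr
          _ = _ := by ring
      linarith [neg_abs_le (p * (|x| ^ (p - 2) * x * y))]
    nlinarith [mul_nonneg h1 hA, mul_nonneg h2 hA, mul_nonneg (sq_nonneg p) hA,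
      mul_nonneg (sq_nonneg p) hyp]
  · have hxpos : 0 < |x| := lt_of_le_of_lt (by positivity) h
    have hx0 : x ≠ 0 := abs_pos.1 hxpos
    set t := y / x with ht
    have hy : y = x * t := by rw [ht]; field_simp
    have ht1 : |t * p| ≤ 1 := by
      rw [abs_mul, abs_of_nonneg hp0, ht, abs_div, div_mul_eq_mul_div, div_le_one hxpos]
      linarith
    have ht2 : 0 ≤ 1 + t := by
      have := abs_le.1 ht1
      nlinarith
    have e1 : (1 + t) ^ p ≤ 1 + t * p + (t * p) ^ 2 := by
      have a1 : (1 + t) ^ p ≤ Real.exp t ^ p :=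
        Real.rpow_le_rpow ht2 (by linarith [Real.add_one_le_exp t]) hp0
      rw [← Real.exp_mul] at a1
      have := (abs_le.1 (Real.abs_exp_sub_one_sub_id_le ht1)).2
      linarith
    have e2 : |x + y| ^ p = |x| ^ p * (1 + t) ^ p := by
      rw [← Real.mul_rpow (abs_nonneg _) ht2, ← abs_of_nonneg ht2, ← abs_mul, hy]
      congr 2; ring
    have e3 : |x| ^ p = |x| ^ (p - 2) * x ^ 2 := by
      rw [← rpow_sub_two_mul_sq hp (abs_nonneg x), sq_abs]
    have e4 : |x + y| ^ p ≤ |x| ^ p + p * (|x| ^ (p - 2) * x * y)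
        + p ^ 2 * (|x| ^ (p - 2) * y ^ 2) := by
      rw [e2]
      refine (mul_le_mul_of_nonneg_left e1 hxp).trans (le_of_eq ?_)
      rw [e3, hy]; ring
    nlinarith [mul_nonneg h1 hA, mul_nonneg h2 hA, mul_nonneg h1 hyp, mul_nonneg h2 hyp,
      mul_nonneg (sq_nonneg p) hyp]

theorem rpow_sub_two_mul_sq_le {p a b : ℝ} (hp : 2 ≤ p) (ha : 0 ≤ a) (hb : 0 ≤ b) :
    a ^ (p - 2) * b ^ 2 ≤ a ^ p + b ^ p := by
  have h1 : 0 ≤ a ^ p := Real.rpow_nonneg ha _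
  have h2 : 0 ≤ b ^ p := Real.rpow_nonneg hb _
  rcases le_total a b with h | h
  · have : a ^ (p - 2) * b ^ 2 ≤ b ^ (p - 2) * b ^ 2 := by gcongr
    rw [rpow_sub_two_mul_sq hp hb] at this; linarith
  · have : a ^ (p - 2) * b ^ 2 ≤ a ^ (p - 2) * a ^ 2 := by gcongr
    rw [rpow_sub_two_mul_sq hp ha] at this; linarith

/-- This replaces Hölder's inequality: when s and z bound the L^p norms of two functions, the
bracket has integral at most 2. -/
theorem rpow_sub_two_mul_sq_le_scaled {p a b s z : ℝ} (hp : 2 ≤ p) (ha : 0 ≤ a) (hb : 0 ≤ b)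
    (hs : 0 < s) (hz : 0 < z) :
    a ^ (p - 2) * b ^ 2 ≤ s ^ (p - 2) * z ^ 2 * (a ^ p / s ^ p + b ^ p / z ^ p) := by
  have h := rpow_sub_two_mul_sq_le hp (div_nonneg ha hs.le) (div_nonneg hb hz.le)
  rw [Real.div_rpow ha hs.le, Real.div_rpow ha hs.le, Real.div_rpow hb hz.le, div_pow] at h
  have hs2 : 0 < s ^ (p - 2) := Real.rpow_pos_of_pos hs _
  have hz2 : 0 < z ^ 2 := by positivity
  refine le_trans (le_of_eq ?_) (mul_le_mul_of_nonneg_left h (by positivity))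
  field_simp

theorem abs_rpow_sub_two_mul_mul_le {p : ℝ} (hp : 2 ≤ p) (x y : ℝ) :
    |(|x| ^ (p - 2) * x * y)| ≤ |x| ^ p + |y| ^ p := by
  have hx2 : 0 ≤ |x| ^ (p - 2) := Real.rpow_nonneg (abs_nonneg _) _
  have h1 : 0 ≤ |x| ^ p := Real.rpow_nonneg (abs_nonneg _) _
  have h2 := rpow_sub_two_mul_sq_le hp (abs_nonneg x) (abs_nonneg y)
  have h3 := rpow_sub_two_mul_sq hp (abs_nonneg x)
  have h4 : 0 ≤ |y| ^ p := Real.rpow_nonneg (abs_nonneg _) _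
  rw [abs_mul, abs_mul, abs_of_nonneg hx2]
  nlinarith [sq_nonneg (|x| - |y|), mul_nonneg hx2 (sq_nonneg (|x| - |y|))]

/-- Write the right side as W (s² + 4Cz²), where W is the base to the power p/2 - 1. Since W
dominates both s^(p-2) and z^(p-2), one half of 4Cz² absorbs the mixed term and the other half
absorbs z^p. -/
theorem rpow_add_add_le {p s z C : ℝ} (hp : 2 ≤ p) (hs : 0 < s) (hz : 0 < z) (hC : 1 ≤ C) :
    s ^ p + C * (2 * (s ^ (p - 2) * z ^ 2) + z ^ p) ≤ ((s ^ 2 + 4 * C * z ^ 2) ^ (p / 2)) := by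
  set r := p / 2 with hr
  have hr1 : 0 ≤ r - 1 := by rw [hr]; linarith
  set d := 4 * C * z ^ 2 with hd
  have hd0 : 0 < d := by positivity
  have hs2 : 0 < s ^ 2 := by positivity
  have hz2 : 0 < z ^ 2 := by positivity
  have e0 : (s ^ 2 + d) ^ r = (s ^ 2 + d) ^ (r - 1) * (s ^ 2 + d) := by
    rw [← Real.rpow_add_one (by positivity)]; congr 1; ring
  have e1 : (s ^ 2) ^ (r - 1) ≤ (s ^ 2 + d) ^ (r - 1) := by gcongr; linarith
  have e2 : (z ^ 2) ^ (r - 1) ≤ (s ^ 2 + d) ^ (r - 1) := by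
    gcongr; nlinarith
  have e3 : ∀ u : ℝ, 0 < u → (u ^ 2) ^ (r - 1) = u ^ (p - 2) := by
    intro u hu
    rw [← Real.rpow_natCast, ← Real.rpow_mul hu.le]; congr 1; push_cast; rw [hr]; ring
  rw [e3 s hs] at e1
  rw [e3 z hz] at e2
  rw [e0, ← rpow_sub_two_mul_sq hp hs.le, ← rpow_sub_two_mul_sq hp hz.le]
  have i1 := mul_le_mul_of_nonneg_right e1 hs2.le
  have i2 := mul_le_mul_of_nonneg_right e1 (by positivity : 0 ≤ 2 * C * z ^ 2)
  have i3 := mul_le_mul_of_nonneg_right e2 (by positivity : 0 ≤ 2 * C * z ^ 2)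
  have i4 : 0 ≤ C * (z ^ (p - 2) * z ^ 2) := by positivity
  rw [hd] at *
  nlinarith

/-! ### A moment inequality for orthogonal increments -/

section Moment

variable {Ω : Type*} [MeasurableSpace Ω] {P : Measure Ω}

theorem memLp_ofReal_iff_integrable {p : ℝ} (hp : 2 ≤ p) {f : Ω → ℝ}
    (hf : AEStronglyMeasurable f P) :
    MemLp f (ENNReal.ofReal p) P ↔ Integrable (fun ω => |f ω| ^ p) P := by
  have := integrable_norm_rpow_iff (μ := P) hf (p := ENNReal.ofReal p)
    (by simp; linarith) (by simp)
  rw [ENNReal.toReal_ofReal (by linarith)] at this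
  exact this.symm

theorem eLpNorm_le_ofReal_iff {p c : ℝ} (hp : 2 ≤ p) (hc : 0 ≤ c) {f : Ω → ℝ}
    (hf : MemLp f (ENNReal.ofReal p) P) :
    eLpNorm f (ENNReal.ofReal p) P ≤ ENNReal.ofReal c ↔ ∫ ω, |f ω| ^ p ∂P ≤ c ^ p := by
  have hp0 : 0 < p := by linarith
  rw [hf.eLpNorm_eq_integral_rpow_norm (by simp; linarith) (by simp),
    ENNReal.ofReal_le_ofReal_iff hc, ENNReal.toReal_ofReal hp0.le]
  have h0 : 0 ≤ ∫ ω, |f ω| ^ p ∂P := integral_nonneg fun ω => Real.rpow_nonneg (abs_nonneg _) _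
  simp only [Real.norm_eq_abs]
  rw [Real.rpow_inv_le_iff_of_pos h0 hc hp0]

/-- One step of the martingale inequality: the Taylor bound is integrated, and orthogonality removes
its linear term. The squared norm then grows only by a multiple of z², instead of the norm growing
by z. -/
theorem integral_abs_add_rpow_le {p : ℝ} (hp : 2 ≤ p) {f g : Ω → ℝ}
    (hf : MemLp f (ENNReal.ofReal p) P) (hg : MemLp g (ENNReal.ofReal p) P)
    (h0 : ∫ ω, |f ω| ^ (p - 2) * f ω * g ω ∂P = 0) {s z : ℝ} (hs : 0 < s) (hz : 0 < z)
    (hfs : ∫ ω, |f ω| ^ p ∂P ≤ s ^ p) (hgz : ∫ ω, |g ω| ^ p ∂P ≤ z ^ p) :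
    ∫ ω, |f ω + g ω| ^ p ∂P ≤ (s ^ 2 + 4 * taylorConst p * z ^ 2) ^ (p / 2) := by
  have hf' := (memLp_ofReal_iff_integrable hp hf.1).1 hf
  have hg' := (memLp_ofReal_iff_integrable hp hg.1).1 hg
  have hfg' := (memLp_ofReal_iff_integrable hp (hf.add hg).1).1 (hf.add hg)
  have hmf := hf.1.aemeasurable
  have hmg := hg.1.aemeasurable
  have hcross : Integrable (fun ω => |f ω| ^ (p - 2) * f ω * g ω) P := by
    refine (hf'.add hg').mono' (by fun_prop) (.of_forall fun ω => ?_)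
    exact abs_rpow_sub_two_mul_mul_le hp _ _
  have hsp : 0 < s ^ p := Real.rpow_pos_of_pos hs _
  have hzp : 0 < z ^ p := Real.rpow_pos_of_pos hz _
  have hs2 : 0 < s ^ (p - 2) := Real.rpow_pos_of_pos hs _
  have hC := one_le_taylorConst hp
  refine le_trans ?_ (rpow_add_add_le hp hs hz hC)
  have hpt : ∀ ω, |f ω + g ω| ^ p ≤ |f ω| ^ p + p * (|f ω| ^ (p - 2) * f ω * g ω)
      + taylorConst p * (s ^ (p - 2) * z ^ 2 * (|f ω| ^ p / s ^ p + |g ω| ^ p / z ^ p)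
        + |g ω| ^ p) := by
    intro ω
    refine (abs_add_rpow_le hp _ _).trans ?_
    have := rpow_sub_two_mul_sq_le_scaled hp (abs_nonneg (f ω)) (abs_nonneg (g ω)) hs hz
    rw [sq_abs] at this
    gcongr
  have i1 := hcross.const_mul p
  have i2 := ((((hf'.div_const (s ^ p)).add (hg'.div_const (z ^ p))).const_mul
    (s ^ (p - 2) * z ^ 2)).add hg').const_mul (taylorConst p)
  have i3 := ((hf'.div_const (s ^ p)).add (hg'.div_const (z ^ p))).const_mul
    (s ^ (p - 2) * z ^ 2)
  refine (integral_mono hfg' ((hf'.add i1).add i2) hpt).trans ?_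
  simp only [Pi.add_apply] at *
  rw [integral_add (by exact hf'.add i1) i2, integral_add hf' i1, integral_const_mul, h0,
    integral_const_mul, integral_add i3 hg', integral_const_mul,
    integral_add (hf'.div_const _) (hg'.div_const _), integral_div, integral_div]
  have j1 : (∫ ω, |f ω| ^ p ∂P) / s ^ p ≤ 1 := (div_le_one hsp).2 hfs
  have j2 : (∫ ω, |g ω| ^ p ∂P) / z ^ p ≤ 1 := (div_le_one hzp).2 hgz
  have : s ^ (p - 2) * z ^ 2 * ((∫ ω, |f ω| ^ p ∂P) / s ^ p + (∫ ω, |g ω| ^ p ∂P) / z ^ p)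
      ≤ 2 * (s ^ (p - 2) * z ^ 2) := by
    nlinarith [mul_pos hs2 (sq_pos_of_pos hz)]
  nlinarith

/-- A moment inequality of Burkholder type: if each increment is orthogonal to the power
`|M| ^ (p - 2) * M` of the preceding partial sum `M`, then the squared `L^p` norm of the sum is
bounded by a constant times the sum of the squared `L^p` norms of the increments. -/
theorem eLpNorm_sum_le_sqrt_of_orthogonal {p : ℝ} (hp : 2 ≤ p) {Z : ℕ → Ω → ℝ} {z : ℕ → ℝ}
    {n : ℕ} (hn : 0 < n)
    (hZ : ∀ k < n, MemLp (Z k) (ENNReal.ofReal p) P) (hz : ∀ k < n, 0 < z k)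
    (hZz : ∀ k < n, eLpNorm (Z k) (ENNReal.ofReal p) P ≤ ENNReal.ofReal (z k))
    (h0 : ∀ k < n, ∫ ω, |∑ l ∈ Finset.range k, Z l ω| ^ (p - 2) *
      (∑ l ∈ Finset.range k, Z l ω) * Z k ω ∂P = 0) :
    eLpNorm (fun ω => ∑ l ∈ Finset.range n, Z l ω) (ENNReal.ofReal p) P ≤
      ENNReal.ofReal (√(8 * taylorConst p * ∑ l ∈ Finset.range n, z l ^ 2)) := by
  have hC := one_le_taylorConst hp
  have hmem : ∀ k ≤ n, MemLp (fun ω => ∑ l ∈ Finset.range k, Z l ω) (ENNReal.ofReal p) P :=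
    fun k hk => memLp_finsetSum _ fun l hl => hZ l ((Finset.mem_range.1 hl).trans_le hk)
  have hpos : ∀ k, 0 ≤ ∑ l ∈ Finset.range k, z l ^ 2 :=
    fun k => Finset.sum_nonneg fun _ _ => sq_nonneg _
  -- The extra z 0 ^ 2 keeps the bound positive for the empty sum, as the one-step inequality
  -- divides by it. In the end it is at most the whole sum, which turns the factor 4 into 8.
  have key : ∀ k ≤ n, ∫ ω, |∑ l ∈ Finset.range k, Z l ω| ^ p ∂P ≤
      (√(4 * taylorConst p * (z 0 ^ 2 + ∑ l ∈ Finset.range k, z l ^ 2))) ^ p := by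
    intro k
    induction k with
    | zero =>
      intro _
      simp [Real.zero_rpow (by linarith : p ≠ 0)]
      positivity
    | succ k ih =>
      intro hk
      have hz0 := hz 0 hn
      have hb : 0 < z 0 ^ 2 + ∑ l ∈ Finset.range k, z l ^ 2 :=
        add_pos_of_pos_of_nonneg (by positivity) (hpos k)
      have := integral_abs_add_rpow_le hp (hmem k (by omega)) (hZ k hk) (h0 k hk)
        (Real.sqrt_pos.2 (by positivity)) (hz k hk) (ih (by omega))
        ((eLpNorm_le_ofReal_iff hp (hz k hk).le (hZ k hk)).1 (hZz k hk))
      rw [Real.sq_sqrt (by positivity)] at this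
      simp only [Finset.sum_range_succ]
      refine this.trans (le_of_eq ?_)
      rw [Real.sqrt_eq_rpow, ← Real.rpow_mul (by positivity)]
      congr 1 <;> ring
  rw [eLpNorm_le_ofReal_iff hp (Real.sqrt_nonneg _) (hmem n le_rfl)]
  refine (key n le_rfl).trans ?_
  gcongr ?_ ^ p
  refine Real.sqrt_le_sqrt ?_
  have : z 0 ^ 2 ≤ ∑ l ∈ Finset.range n, z l ^ 2 :=
    Finset.single_le_sum (f := fun l => z l ^ 2) (fun _ _ => sq_nonneg _) (Finset.mem_range.2 hn)
  nlinarith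

end Moment

/-! ### Products of factors 1 + t f and linear recursions -/

section Propagator

variable {𝕜 E : Type*} [Field 𝕜] [AddCommGroup E] [Module 𝕜 E]

/-- The product of the factors `1 + t k • f` over `i ≤ k < n`. -/
def propagator (f : Module.End 𝕜 E) (t : ℕ → 𝕜) (i : ℕ) : ℕ → Module.End 𝕜 E
  | 0 => 1
  | n + 1 => if n < i then 1 else (1 + t n • f) * propagator f t i n

theorem propagator_of_le (f : Module.End 𝕜 E) (t : ℕ → 𝕜) {i n : ℕ} (h : n ≤ i) :
    propagator f t i n = 1 := by
  cases n with
  | zero => rfl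
  | succ n => rw [propagator, if_pos (by omega)]

theorem propagator_succ (f : Module.End 𝕜 E) (t : ℕ → 𝕜) {i n : ℕ} (h : i ≤ n) :
    propagator f t i (n + 1) = (1 + t n • f) * propagator f t i n := by
  rw [propagator, if_neg (by omega)]

theorem propagator_succ_apply (f : Module.End 𝕜 E) (t : ℕ → 𝕜) {i n : ℕ} (h : i ≤ n) (v : E) :
    propagator f t i (n + 1) v = propagator f t i n v + t n • f (propagator f t i n v) := by
  rw [propagator_succ f t h]; simp

theorem propagator_commute (f : Module.End 𝕜 E) (t : ℕ → 𝕜) (i n : ℕ) :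
    Commute f (propagator f t i n) := by
  induction n with
  | zero => exact Commute.one_right f
  | succ n ih =>
    rw [propagator]
    split_ifs
    · exact Commute.one_right f
    · exact ((Commute.one_right f).add_right ((Commute.refl f).smul_right _)).mul_right ih

theorem apply_propagator_comm (f : Module.End 𝕜 E) (t : ℕ → 𝕜) (i n : ℕ) (v : E) :
    f (propagator f t i n v) = propagator f t i n (f v) :=
  LinearMap.congr_fun (propagator_commute f t i n).eq v

/-- Splitting f into μ and f - μ isolates a scalar factor; the remainder involves a vector of lower
nilpotency order, which permits induction on that order. -/
theorem propagator_succ_apply_sub (f : Module.End 𝕜 E) (t : ℕ → 𝕜) {i n : ℕ} (h : i ≤ n)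
    (μ : 𝕜) (v : E) :
    propagator f t i (n + 1) v = (1 + t n * μ) • propagator f t i n v +
      t n • propagator f t i n ((f - μ • (1 : Module.End 𝕜 E)) v) := by
  rw [propagator_succ_apply f t h, apply_propagator_comm]
  simp only [LinearMap.sub_apply, LinearMap.smul_apply, Module.End.one_apply, map_sub, map_smul]
  module

/-- Variation of constants for the recursion `x (n + 1) = x n + t n • f (x n) + y n`. -/
theorem eq_propagator_add_sum (f : Module.End 𝕜 E) (t : ℕ → 𝕜) (x y : ℕ → E)
    (hx : ∀ n, x (n + 1) = x n + t n • f (x n) + y n) (n : ℕ) :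
    x n = propagator f t 0 n (x 0) + ∑ l ∈ Finset.range n, propagator f t (l + 1) n (y l) := by
  induction n with
  | zero => simp [propagator_of_le]
  | succ n ih =>
    rw [Finset.sum_range_succ, propagator_of_le f t (le_refl (n + 1)),
      propagator_succ_apply f t (Nat.zero_le n),
      Finset.sum_congr rfl fun l hl =>
        propagator_succ_apply f t (i := l + 1) (n := n) (Finset.mem_range.1 hl) (y l),
      Finset.sum_add_distrib, ← Finset.smul_sum, ← map_sum, hx]
    conv_lhs => rw [ih]
    simp only [map_add, smul_add, Module.End.one_apply]
    abel

end Propagator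

/-- The urn is real while the spectral decomposition is complex; this carries growth bounds back to
the real matrix. -/
theorem ofReal_propagator_mulVec {ι : Type*} [Fintype ι] [DecidableEq ι] (A : Matrix ι ι ℝ)
    (t : ℕ → ℝ) (i n : ℕ) (v : ι → ℝ) :
    propagator (Matrix.toLin' (A.map (algebraMap ℝ ℂ))) (fun k => (t k : ℂ)) i n
      (fun j => (v j : ℂ)) = fun j => ((propagator (Matrix.toLin' A) t i n v j : ℝ) : ℂ) := by
  induction n with
  | zero => simp [propagator_of_le]
  | succ n ih =>
    rcases lt_or_ge n i with h | h
    · simp [propagator_of_le _ _ (Nat.succ_le_of_lt h)]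
    · rw [propagator_succ_apply _ _ h, propagator_succ_apply _ _ h, ih]
      ext j
      simp [Matrix.mulVec, dotProduct]

/-! ### Growth of the products on generalized eigenspaces -/

theorem norm_one_add_le_exp (z : ℂ) : ‖1 + z‖ ≤ Real.exp (z.re + ‖z‖ ^ 2 / 2) := by
  have h1 : ‖1 + z‖ ^ 2 = 1 + 2 * z.re + ‖z‖ ^ 2 := by
    rw [Complex.sq_norm, Complex.sq_norm, Complex.normSq_apply, Complex.normSq_apply]
    simp; ring
  have h2 : ‖1 + z‖ ^ 2 ≤ Real.exp (z.re + ‖z‖ ^ 2 / 2) ^ 2 := by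
    rw [h1, ← Real.exp_nat_mul]
    refine le_trans (le_of_eq ?_) (Real.add_one_le_exp _)
    push_cast; ring
  exact le_of_sq_le_sq h2 (Real.exp_pos _).le

theorem exists_one_add_pow_le_exp (d : ℕ) {δ : ℝ} (hδ : 0 < δ) :
    ∃ C : ℝ, 0 ≤ C ∧ ∀ h : ℝ, 0 ≤ h → (1 + h) ^ d ≤ C * Real.exp (δ * h) := by
  refine ⟨d.factorial * Real.exp δ / δ ^ d, by positivity, fun h hh => ?_⟩
  have := Real.pow_div_factorial_le_exp (δ * (1 + h)) (by positivity) d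
  rw [div_le_iff₀ (by positivity), mul_pow, mul_add, mul_one, Real.exp_add] at this
  rw [div_mul_eq_mul_div, le_div_iff₀ (by positivity)]
  linarith

section Growth

variable {E : Type*} [NormedAddCommGroup E] [NormedSpace ℂ E]

open Finset in
-- Induction on d replaces the Jordan form. Each new factor multiplies by 1 + τ μ and adds τ times
-- the product applied to (f - μ) v, which has one power of 1 + H less; summing the contributions τ
-- (1 + H)^d restores that power.
theorem norm_propagator_le_of_sub_pow_eq_zero (f : Module.End ℂ E) (μ : ℂ) {τ : ℕ → ℝ} {T : ℝ}
    (hτ : ∀ k, 0 ≤ τ k) (hT : ∀ k, τ k ≤ T) (d : ℕ) :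
    ∀ v : E, ((f - μ • (1 : Module.End ℂ E)) ^ (d + 1)) v = 0 → ∃ C : ℝ, 0 ≤ C ∧ ∀ i n, i ≤ n →
      ‖propagator f (fun k => (τ k : ℂ)) i n v‖ ≤ C * Real.exp (μ.re * (∑ k ∈ Ico i n, τ k) +
        ‖μ‖ ^ 2 / 2 * ∑ k ∈ Ico i n, τ k ^ 2) * (1 + ∑ k ∈ Ico i n, τ k) ^ d := by
  have hr : ∀ k, ‖1 + (τ k : ℂ) * μ‖ ≤ Real.exp (μ.re * τ k + ‖μ‖ ^ 2 / 2 * τ k ^ 2) := by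
    intro k
    refine (norm_one_add_le_exp _).trans (le_of_eq ?_)
    congr 1
    simp only [Complex.re_ofReal_mul, norm_mul, Complex.norm_real, Real.norm_eq_abs, mul_pow,
      sq_abs]
    ring
  have hexp : ∀ i n, i ≤ n → Real.exp (μ.re * (∑ k ∈ Ico i (n + 1), τ k) +
        ‖μ‖ ^ 2 / 2 * ∑ k ∈ Ico i (n + 1), τ k ^ 2) =
      Real.exp (μ.re * τ n + ‖μ‖ ^ 2 / 2 * τ n ^ 2) * Real.exp (μ.re * (∑ k ∈ Ico i n, τ k) +
        ‖μ‖ ^ 2 / 2 * ∑ k ∈ Ico i n, τ k ^ 2) := by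
    intro i n h
    rw [sum_Ico_succ_top h, sum_Ico_succ_top h, ← Real.exp_add]
    congr 1; ring
  induction d with
  | zero =>
    intro v hv
    refine ⟨‖v‖, norm_nonneg _, fun i n h => ?_⟩
    induction n, h using Nat.le_induction with
    | base => simp [propagator_of_le]
    | succ n h ih =>
      rw [zero_add, pow_one] at hv
      rw [propagator_succ_apply_sub _ _ h μ, hv, map_zero, smul_zero, add_zero, norm_smul,
        hexp i n h]
      refine (mul_le_mul (hr n) ih (norm_nonneg _) (Real.exp_pos _).le).trans (le_of_eq ?_)
      ring
  | succ d ihd =>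
    intro v hv
    obtain ⟨C', hC', hb⟩ := ihd ((f - μ • (1 : Module.End ℂ E)) v) (by
      rw [← Module.End.mul_apply, ← pow_succ]; exact hv)
    set K := Real.exp (T * |μ.re|) with hK
    refine ⟨‖v‖ + K * C', by positivity, fun i n h => ?_⟩
    induction n, h using Nat.le_induction with
    | base => simp [propagator_of_le]; positivity
    | succ n h ih =>
      have hb' := hb i n h
      rw [propagator_succ_apply_sub _ _ h μ, hexp i n h, sum_Ico_succ_top h]
      set X := Real.exp (μ.re * (∑ k ∈ Ico i n, τ k) + ‖μ‖ ^ 2 / 2 * ∑ k ∈ Ico i n, τ k ^ 2)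
      set r := Real.exp (μ.re * τ n + ‖μ‖ ^ 2 / 2 * τ n ^ 2) with hrdef
      have hh : 0 ≤ ∑ k ∈ Ico i n, τ k := sum_nonneg fun k _ => hτ k
      set H := ∑ k ∈ Ico i n, τ k
      have hX : 0 ≤ X := (Real.exp_pos _).le
      have hτn := hτ n
      have hrpos : 0 < r := Real.exp_pos _
      -- The added term lacks the factor r of the new step, and r may be less than 1 when Re μ is
      -- negative. Bounded step sizes make K compensate for this.
      have hKr : 1 ≤ K * r := by
        rw [hK, hrdef, ← Real.exp_add, ← Real.exp_zero]
        refine Real.exp_le_exp.2 ?_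
        have h1 : -(T * |μ.re|) ≤ μ.re * τ n := by
          nlinarith [neg_abs_le μ.re, abs_nonneg μ.re, hT n]
        have h2 : 0 ≤ ‖μ‖ ^ 2 / 2 * τ n ^ 2 := by positivity
        linarith
      calc _ ≤ ‖1 + (τ n : ℂ) * μ‖ * ‖propagator f (fun k => (τ k : ℂ)) i n v‖ + τ n *
            ‖propagator f (fun k => (τ k : ℂ)) i n ((f - μ • (1 : Module.End ℂ E)) v)‖ := by
            refine (norm_add_le _ _).trans (le_of_eq ?_)
            rw [norm_smul, norm_smul, Complex.norm_real, Real.norm_of_nonneg hτn]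
        _ ≤ r * ((‖v‖ + K * C') * X * (1 + H) ^ (d + 1)) + τ n * (C' * X * (1 + H) ^ d) := by
            gcongr; exact hr n
        _ ≤ r * ((‖v‖ + K * C') * X * (1 + H) ^ (d + 1)) +
              (K * r) * (τ n * (C' * X * (1 + H) ^ d)) := by
            refine add_le_add le_rfl (le_mul_of_one_le_left (by positivity) hKr)
        _ ≤ (‖v‖ + K * C') * (r * X) * ((1 + H) ^ d * (1 + (H + τ n))) := by
            have : 0 ≤ ‖v‖ * r * X * (1 + H) ^ d * τ n := by positivity
            rw [pow_succ]
            nlinarith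
        _ ≤ _ := by
            rw [pow_succ (1 + (H + τ n)) d]
            gcongr
            linarith

open Finset in
/-- The vectors on which the propagators grow at most like `exp (ρ h) * (1 + h) ^ ν`, where `h`
is the sum of the step sizes. -/
def growthSubmodule (f : Module.End ℂ E) (τ : ℕ → ℝ) (ρ : ℝ) (ν : ℕ) :
    Submodule ℂ E where
  carrier := {v | ∃ C : ℝ, 0 ≤ C ∧ ∀ i n, i ≤ n → ‖propagator f (fun k => (τ k : ℂ)) i n v‖ ≤
    C * (Real.exp (ρ * ∑ k ∈ Ico i n, τ k) * (1 + ∑ k ∈ Ico i n, τ k) ^ ν)}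
  add_mem' := by
    rintro v w ⟨C, hC, h⟩ ⟨D, hD, h'⟩
    refine ⟨C + D, by positivity, fun i n hin => ?_⟩
    rw [map_add, add_mul]
    exact (norm_add_le _ _).trans (add_le_add (h i n hin) (h' i n hin))
  zero_mem' := ⟨0, le_rfl, fun i n _ => by simp⟩
  smul_mem' := by
    rintro c v ⟨C, hC, h⟩
    refine ⟨‖c‖ * C, by positivity, fun i n hin => ?_⟩
    rw [map_smul, norm_smul, mul_assoc]
    exact mul_le_mul_of_nonneg_left (h i n hin) (norm_nonneg _)

open Finset in
-- Square summable steps turn the second order error in the exponent into a constant. A strict gap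
-- μ.re < ρ absorbs any polynomial factor; at equality the degrees must be compared.
theorem mem_growthSubmodule_of_sub_pow_eq_zero (f : Module.End ℂ E) (μ : ℂ) {τ : ℕ → ℝ}
    {T S : ℝ} (hτ : ∀ k, 0 ≤ τ k) (hT : ∀ k, τ k ≤ T) (hS : ∀ i n, ∑ k ∈ Ico i n, τ k ^ 2 ≤ S)
    {d : ℕ} {v : E} (hv : ((f - μ • (1 : Module.End ℂ E)) ^ (d + 1)) v = 0) {ρ : ℝ} {ν : ℕ}
    (h : μ.re < ρ ∨ μ.re = ρ ∧ d ≤ ν) : v ∈ growthSubmodule f τ ρ ν := by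
  obtain ⟨C, hC, hb⟩ := norm_propagator_le_of_sub_pow_eq_zero f μ hτ hT d v hv
  have key : ∃ D : ℝ, 0 ≤ D ∧ ∀ x : ℝ, 0 ≤ x →
      Real.exp (μ.re * x) * (1 + x) ^ d ≤ D * (Real.exp (ρ * x) * (1 + x) ^ ν) := by
    rcases h with h | ⟨h, hd⟩
    · obtain ⟨D, hD, hD'⟩ := exists_one_add_pow_le_exp d (sub_pos.2 h)
      refine ⟨D, hD, fun x hx => ?_⟩
      calc Real.exp (μ.re * x) * (1 + x) ^ d ≤
            Real.exp (μ.re * x) * (D * Real.exp ((ρ - μ.re) * x)) := by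
              gcongr; exact hD' x hx
        _ = D * (Real.exp (ρ * x) * 1) := by
              rw [mul_left_comm, ← Real.exp_add]; ring_nf
        _ ≤ _ := by gcongr; exact one_le_pow₀ (by linarith)
    · refine ⟨1, zero_le_one, fun x hx => ?_⟩
      rw [h, one_mul]
      gcongr
      linarith
  obtain ⟨D, hD, hD'⟩ := key
  refine ⟨C * Real.exp (‖μ‖ ^ 2 / 2 * S) * D, by positivity, fun i n hin => ?_⟩
  have hh : 0 ≤ ∑ k ∈ Ico i n, τ k := sum_nonneg fun k _ => hτ k
  refine (hb i n hin).trans ?_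
  rw [Real.exp_add]
  calc _ = C * Real.exp (‖μ‖ ^ 2 / 2 * ∑ k ∈ Ico i n, τ k ^ 2) *
        (Real.exp (μ.re * ∑ k ∈ Ico i n, τ k) * (1 + ∑ k ∈ Ico i n, τ k) ^ d) := by ring
    _ ≤ C * Real.exp (‖μ‖ ^ 2 / 2 * S) *
        (D * (Real.exp (ρ * ∑ k ∈ Ico i n, τ k) * (1 + ∑ k ∈ Ico i n, τ k) ^ ν)) := by
      refine mul_le_mul ?_ (hD' _ hh) (by positivity) (by positivity)
      gcongr
      exact hS i n
    _ = _ := by ring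

end Growth

/-! ### The kernel of the left eigenvector and the ordered spectrum -/

/-- Since φ ((f - μ)^k v) = (β - μ)^k φ v, the functional vanishes on every generalized eigenspace
with μ ≠ β. Being nonzero, it is nonzero on a generator of the space for β, so a vector in its
kernel has no component there. -/
theorem ker_le_iSup_maxGenEigenspace_ne {K E : Type*} [Field K] [IsAlgClosed K]
    [AddCommGroup E] [Module K E] [FiniteDimensional K E] (f : Module.End K E) (φ : E →ₗ[K] K)
    (hφ : φ ≠ 0) {β : K} (hφf : φ ∘ₗ f = β • φ)
    (hβ : Module.finrank K (f.maxGenEigenspace β) ≤ 1) :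
    LinearMap.ker φ ≤ ⨆ (μ : K) (_ : μ ≠ β), f.maxGenEigenspace μ := by
  have hpow : ∀ (μ : K) (k : ℕ) (v : E),
      φ (((f - μ • (1 : Module.End K E)) ^ k) v) = (β - μ) ^ k * φ v := by
    intro μ k
    induction k with
    | zero => simp
    | succ k ih =>
      intro v
      have : φ (f v) = β * φ v := LinearMap.congr_fun hφf v
      rw [pow_succ, Module.End.mul_apply, ih, LinearMap.sub_apply, map_sub, this]
      simp; ring
  have hH : (⨆ (μ : K) (_ : μ ≠ β), f.maxGenEigenspace μ) ≤ LinearMap.ker φ := by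
    refine iSup₂_le fun μ hμ v hv => ?_
    obtain ⟨k, hk⟩ := (Module.End.mem_maxGenEigenspace f μ v).1 hv
    have := hpow μ k v
    rw [hk, map_zero] at this
    rcases mul_eq_zero.1 this.symm with h | h
    · exact absurd h (pow_ne_zero k (sub_ne_zero.2 hμ.symm))
    · exact h
  have htop := Module.End.iSup_maxGenEigenspace_eq_top f
  rw [iSup_split_single _ β] at htop
  have hdec : ∀ v : E, ∃ e ∈ f.maxGenEigenspace β,
      ∃ h ∈ ⨆ (μ : K) (_ : μ ≠ β), f.maxGenEigenspace μ, e + h = v := fun v =>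
    Submodule.mem_sup.1 (htop ▸ Submodule.mem_top)
  obtain ⟨g, hg⟩ := finrank_le_one_iff.1 hβ
  have hφg : φ g ≠ 0 := by
    intro h0
    refine hφ (LinearMap.ext fun v => ?_)
    obtain ⟨e, he, h, hh, rfl⟩ := hdec v
    obtain ⟨c, hc⟩ := hg ⟨e, he⟩
    have : e = c • (g : E) := congrArg Subtype.val hc.symm
    rw [map_add, LinearMap.mem_ker.1 (hH hh), this, map_smul, h0]; simp
  intro v hv
  obtain ⟨e, he, h, hh, rfl⟩ := hdec v
  obtain ⟨c, hc⟩ := hg ⟨e, he⟩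
  have he' : e = c • (g : E) := congrArg Subtype.val hc.symm
  rw [LinearMap.mem_ker, map_add, LinearMap.mem_ker.1 (hH hh), he', map_smul, add_zero,
    smul_eq_mul, mul_eq_zero, or_iff_left hφg] at hv
  rw [he', hv, zero_smul, zero_add]
  exact hh

/-- In finite dimension some power works, so the infimum over naturals defining `jordanIndex` is
attained and is not the default value 0 of an empty set. -/
theorem sub_pow_jordanIndex_succ_apply {q : ℕ} (A : Matrix (Fin q) (Fin q) ℂ) (μ : ℂ)
    {v : Fin q → ℂ} (hv : v ∈ Module.End.maxGenEigenspace (Matrix.toLin' A) μ) :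
    ((Matrix.toLin' A - μ • (1 : Module.End ℂ (Fin q → ℂ))) ^ (jordanIndex A μ + 1)) v = 0 := by
  have hne : {k : ℕ | ∀ v ∈ Module.End.maxGenEigenspace (Matrix.toLin' A) μ,
    ((Matrix.toLin' A - μ • (1 : Module.End ℂ (Fin q → ℂ))) ^ (k + 1)) v = 0}.Nonempty := by
    refine ⟨Module.finrank ℂ (Fin q → ℂ), fun w hw => ?_⟩
    rw [Module.End.maxGenEigenspace_eq_genEigenspace_finrank, Module.End.mem_genEigenspace_nat,
      LinearMap.mem_ker] at hw
    rw [pow_succ', Module.End.mul_apply, hw, map_zero]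
  exact Nat.sInf_mem hne v hv

section Ordering

variable {q : ℕ} {A : Matrix (Fin q) (Fin q) ℂ} {ev : Fin q → ℂ}

theorem IsEigenvalueOrdering.exists_eq (h : IsEigenvalueOrdering A ev) {μ : ℂ}
    (hμ : Module.End.maxGenEigenspace (Matrix.toLin' A) μ ≠ ⊥) : ∃ k, ev k = μ := by
  have h1 : 0 < Module.finrank ℂ (Module.End.maxGenEigenspace (Matrix.toLin' A) μ) := by
    rw [Nat.pos_iff_ne_zero]
    exact fun h0 => hμ (Submodule.finrank_eq_zero.1 h0)
  rw [LinearMap.finrank_maxGenEigenspace_eq, Matrix.charpoly_toLin',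
    ← Polynomial.count_roots, ← h.roots_eq, Multiset.count_pos] at h1
  simpa using h1

/-- The strict gap lets only index 0 carry the first eigenvalue, and the dimension of a generalized
eigenspace is the algebraic multiplicity. -/
theorem IsEigenvalueOrdering.finrank_maxGenEigenspace_le_one (h : IsEigenvalueOrdering A ev)
    (hq0 : 0 < q) (hq1 : 1 < q) (h1 : (ev ⟨1, hq1⟩).re < (ev ⟨0, hq0⟩).re) :
    Module.finrank ℂ (Module.End.maxGenEigenspace (Matrix.toLin' A) (ev ⟨0, hq0⟩)) ≤ 1 := by
  rw [LinearMap.finrank_maxGenEigenspace_eq, Matrix.charpoly_toLin',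
    ← Polynomial.count_roots, ← h.roots_eq, Multiset.count_map]
  have : (Finset.univ.filter fun k => ev ⟨0, hq0⟩ = ev k) ⊆ {⟨0, hq0⟩} := by
    intro k hk
    rw [Finset.mem_filter] at hk
    rw [Finset.mem_singleton]
    by_contra hne
    have hk1 : (⟨1, hq1⟩ : Fin q) ≤ k := by
      rw [Fin.le_def]
      have : (k : ℕ) ≠ 0 := fun h0 => hne (Fin.ext h0)
      simp only; omega
    have := h.re_antitone _ _ hk1
    rw [← hk.2] at this
    linarith
  exact (Finset.card_le_card this).trans (by simp)

open Finset in
/-- On the kernel of the left eigenvector of a simple dominant eigenvalue, the propagators grow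
at the rate given by the second eigenvalue. -/
theorem IsEigenvalueOrdering.ker_le_growthSubmodule (h : IsEigenvalueOrdering A ev)
    (hq0 : 0 < q) (hq1 : 1 < q) (h1 : (ev ⟨1, hq1⟩).re < (ev ⟨0, hq0⟩).re)
    (φ : (Fin q → ℂ) →ₗ[ℂ] ℂ) (hφ : φ ≠ 0)
    (hφA : φ ∘ₗ Matrix.toLin' A = ev ⟨0, hq0⟩ • φ) {τ : ℕ → ℝ} {T S : ℝ}
    (hτ : ∀ k, 0 ≤ τ k) (hT : ∀ k, τ k ≤ T) (hS : ∀ i n, ∑ k ∈ Ico i n, τ k ^ 2 ≤ S) :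
    LinearMap.ker φ ≤ growthSubmodule (Matrix.toLin' A) τ (ev ⟨1, hq1⟩).re
      (jordanIndex A (ev ⟨1, hq1⟩)) := by
  refine (ker_le_iSup_maxGenEigenspace_ne _ φ hφ hφA
    (h.finrank_maxGenEigenspace_le_one hq0 hq1 h1)).trans (iSup₂_le fun μ hμ => ?_)
  by_cases hbot : Module.End.maxGenEigenspace (Matrix.toLin' A) μ = ⊥
  · rw [hbot]; exact bot_le
  obtain ⟨k, rfl⟩ := h.exists_eq hbot
  have hk1 : (⟨1, hq1⟩ : Fin q) ≤ k := by
    rw [Fin.le_def]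
    have : (k : ℕ) ≠ 0 := fun h0 => hμ (congrArg ev (Fin.ext h0))
    simp only; omega
  intro v hv
  refine mem_growthSubmodule_of_sub_pow_eq_zero _ _ hτ hT hS
    (sub_pow_jordanIndex_succ_apply A _ hv) ?_
  rcases (h.re_antitone _ _ hk1).lt_or_eq with hlt | heq
  · exact Or.inl hlt
  · exact Or.inr ⟨heq, h.index_antitone _ _ hk1 heq⟩

end Ordering

/-! ### The urn chain and the conditional law of its increments -/

namespace PolyaUrn

variable {q : ℕ} {U : PolyaUrn q} {b : ℝ}

instance (i : Fin q) : IsProbabilityMeasure (U.replacement i) := U.replacement_isProbability i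

theorem totalActivity_add (x y : EuclideanSpace ℝ (Fin q)) :
    U.totalActivity (x + y) = U.totalActivity x + U.totalActivity y := by
  simp [totalActivity, mul_add, Finset.sum_add_distrib]

theorem measurable_totalActivity : Measurable U.totalActivity := by
  unfold totalActivity; fun_prop

theorem measurable_drawProb (i : Fin q) : Measurable fun x => U.drawProb x i := by
  have := U.measurable_totalActivity
  unfold drawProb; fun_prop

theorem drawProb_nonneg {x : EuclideanSpace ℝ (Fin q)} (hx : ∀ i, 0 ≤ x i)
    (h : 0 < U.totalActivity x) (i : Fin q) : 0 ≤ U.drawProb x i :=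
  div_nonneg (mul_nonneg (U.activity_nonneg i) (hx i)) h.le

theorem drawProb_le_one {x : EuclideanSpace ℝ (Fin q)} (hx : ∀ i, 0 ≤ x i)
    (h : 0 < U.totalActivity x) (i : Fin q) : U.drawProb x i ≤ 1 := by
  rw [drawProb, div_le_one h]
  exact Finset.single_le_sum (f := fun i => U.activity i * x i)
    (fun i _ => mul_nonneg (U.activity_nonneg i) (hx i)) (Finset.mem_univ i)

theorem sum_drawProb_mul_integral (x : EuclideanSpace ℝ (Fin q)) (j : Fin q) :
    ∑ i, U.drawProb x i * ∫ y, y j ∂(U.replacement i) =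
      (U.totalActivity x)⁻¹ * Matrix.toLin' U.intensity x.ofLp j := by
  simp only [Matrix.toLin'_apply, Matrix.mulVec, dotProduct, Finset.mul_sum, intensity,
    Matrix.of_apply, drawProb]
  refine Finset.sum_congr rfl fun i _ => ?_
  ring

/-- The total activity of a balanced urn after `n` draws. -/
noncomputable def weight (U : PolyaUrn q) (b : ℝ) (n : ℕ) : ℝ :=
  U.totalActivity U.initial + n * b

theorem weight_succ (U : PolyaUrn q) (b : ℝ) (n : ℕ) : U.weight b (n + 1) = U.weight b n + b := by
  simp [weight]; ring

/-- The activities form a left eigenvector of the intensity matrix of a balanced urn. -/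
theorem IsBalanced.sum_activity_mul_intensity (h : U.IsBalanced b)
    (hint : ∀ i j, Integrable (fun x : EuclideanSpace ℝ (Fin q) => x j) (U.replacement i))
    (k : Fin q) : ∑ i, U.activity i * U.intensity i k = b * U.activity k := by
  have h1 : ∑ i, U.activity i * ∫ x, x i ∂(U.replacement k) = b := by
    simp_rw [← integral_const_mul]
    rw [← integral_finsetSum _ fun i _ => (hint k i).const_mul _]
    have : (fun x : EuclideanSpace ℝ (Fin q) => ∑ i, U.activity i * x i)
        =ᵐ[U.replacement k] fun _ => b := h.2 k
    rw [integral_congr_ae this]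
    simp
  rw [← h1, Finset.sum_mul]
  refine Finset.sum_congr rfl fun i _ => ?_
  simp [intensity]; ring

theorem measurable_history {Ω : Type*} {X : ℕ → Ω → EuclideanSpace ℝ (Fin q)} {k n : ℕ} (h : k ≤ n) : Measurable[history X n] (X k) :=
  Measurable.mono (comap_measurable (X k))
    (le_iSup₂_of_le (f := fun k (_ : k ≤ n) => MeasurableSpace.comap (X k) inferInstance)
      k h le_rfl) le_rfl

section Chain

variable {Ω : Type*} [MeasurableSpace Ω] {P : Measure Ω} {X : ℕ → Ω → EuclideanSpace ℝ (Fin q)}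

theorem IsUrnChain.history_le (hX : U.IsUrnChain P X) (n : ℕ) :
    history X n ≤ ‹MeasurableSpace Ω› :=
  iSup₂_le fun k _ => (hX.measurable k).comap_le

theorem IsUrnChain.measurable_increment (hX : U.IsUrnChain P X) (n : ℕ) :
    Measurable fun ω => X (n + 1) ω - X n ω :=
  (hX.measurable (n + 1)).sub (hX.measurable n)

variable [IsProbabilityMeasure P]

theorem IsUrnChain.integrable_drawProb (hX : U.IsUrnChain P X) (hT : U.IsTenable P X) (n : ℕ)
    (i : Fin q) : Integrable (fun ω => U.drawProb (X n ω) i) P := by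
  refine Integrable.of_bound (C := 1)
    ((measurable_drawProb i).comp (hX.measurable n)).aestronglyMeasurable ?_
  filter_upwards [hT n] with ω hω
  rw [Real.norm_of_nonneg (drawProb_nonneg hω.1 hω.2 i)]
  exact drawProb_le_one hω.1 hω.2 i

/-- Integrating the transition rule over a past event shows that the increment has a mixture of the
replacement laws there. Integrability, almost sure properties and conditional means of increments
all follow by change of variables. -/
theorem IsUrnChain.map_restrict_increment (hX : U.IsUrnChain P X) (hT : U.IsTenable P X) (n : ℕ)
    {S : Set Ω} (hS : MeasurableSet[history X n] S) :
    (P.restrict S).map (fun ω => X (n + 1) ω - X n ω) =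
      ∑ i, ENNReal.ofReal (∫ ω in S, U.drawProb (X n ω) i ∂P) • U.replacement i := by
  have hle := hX.history_le n
  have hc : ∀ i, 0 ≤ ∫ ω in S, U.drawProb (X n ω) i ∂P := fun i =>
    integral_nonneg_of_ae (ae_restrict_of_ae ((hT n).mono fun ω hω =>
      drawProb_nonneg hω.1 hω.2 i))
  ext B hB
  have hE : MeasurableSet {ω | X (n + 1) ω - X n ω ∈ B} := hX.measurable_increment n hB
  have hint : Integrable ({ω | X (n + 1) ω - X n ω ∈ B}.indicator fun _ => (1 : ℝ)) P :=
    (integrable_const _).indicator hE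
  have h1 := setIntegral_condExp hle hint hS
  rw [setIntegral_congr_ae (hle _ hS) ((hX.step n B hB).mono fun ω h _ => h),
    integral_finsetSum _ fun i _ =>
      ((hX.integrable_drawProb hT n i).integrableOn.mul_const _),
    integral_indicator hE] at h1
  simp only [integral_mul_const, integral_const, smul_eq_mul, mul_one] at h1
  rw [Measure.map_apply (hX.measurable_increment n) hB]
  simp only [Measure.coe_finsetSum, Finset.sum_apply, Measure.smul_apply, smul_eq_mul]
  rw [measureReal_def, Measure.restrict_apply_univ, Measure.restrict_apply hE] at h1
  rw [Measure.restrict_apply (hX.measurable_increment n hB)]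
  change P ({ω | X (n + 1) ω - X n ω ∈ B} ∩ S) = _
  rw [← ENNReal.ofReal_toReal (measure_ne_top P _), ← h1,
    ENNReal.ofReal_sum_of_nonneg fun i _ => mul_nonneg (hc i) measureReal_nonneg]
  refine Finset.sum_congr rfl fun i _ => ?_
  rw [ENNReal.ofReal_mul (hc i), measureReal_def, ENNReal.ofReal_toReal (measure_ne_top _ _)]

theorem IsUrnChain.map_increment (hX : U.IsUrnChain P X) (hT : U.IsTenable P X) (n : ℕ) :
    P.map (fun ω => X (n + 1) ω - X n ω) =
      ∑ i, ENNReal.ofReal (∫ ω, U.drawProb (X n ω) i ∂P) • U.replacement i := by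
  simpa using hX.map_restrict_increment hT n (S := Set.univ) MeasurableSet.univ

theorem IsUrnChain.ae_increment (hX : U.IsUrnChain P X) (hT : U.IsTenable P X) (n : ℕ)
    {p : EuclideanSpace ℝ (Fin q) → Prop} (hp : ∀ i, ∀ᵐ x ∂(U.replacement i), p x) :
    ∀ᵐ ω ∂P, p (X (n + 1) ω - X n ω) := by
  refine ae_of_ae_map (hX.measurable_increment n).aemeasurable ?_
  rw [hX.map_increment hT n, ae_iff]
  simp only [Measure.coe_finsetSum, Finset.sum_apply, Measure.smul_apply, smul_eq_mul]
  exact Finset.sum_eq_zero fun i _ => by rw [ae_iff.1 (hp i), mul_zero]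

theorem IsUrnChain.integrable_comp_increment (hX : U.IsUrnChain P X) (hT : U.IsTenable P X)
    (n : ℕ) {f : EuclideanSpace ℝ (Fin q) → ℝ} (hf : ∀ i, Integrable f (U.replacement i)) :
    Integrable (fun ω => f (X (n + 1) ω - X n ω)) P := by
  refine Integrable.comp_measurable (f := fun ω => X (n + 1) ω - X n ω) ?_
    (hX.measurable_increment n)
  rw [hX.map_increment hT n, integrable_finsetSum_measure]
  exact fun i _ => (hf i).smul_measure ENNReal.ofReal_ne_top

theorem IsUrnChain.setIntegral_comp_increment (hX : U.IsUrnChain P X) (hT : U.IsTenable P X)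
    (n : ℕ) {f : EuclideanSpace ℝ (Fin q) → ℝ} (hf : ∀ i, Integrable f (U.replacement i))
    {S : Set Ω} (hS : MeasurableSet[history X n] S) :
    ∫ ω in S, f (X (n + 1) ω - X n ω) ∂P =
      ∑ i, (∫ ω in S, U.drawProb (X n ω) i ∂P) * ∫ x, f x ∂(U.replacement i) := by
  have hc : ∀ i, 0 ≤ ∫ ω in S, U.drawProb (X n ω) i ∂P := fun i =>
    integral_nonneg_of_ae (ae_restrict_of_ae ((hT n).mono fun ω hω =>
      drawProb_nonneg hω.1 hω.2 i))
  have hi : ∀ i ∈ Finset.univ, Integrable f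
      (ENNReal.ofReal (∫ ω in S, U.drawProb (X n ω) i ∂P) • U.replacement i) :=
    fun i _ => (hf i).smul_measure ENNReal.ofReal_ne_top
  rw [← integral_map (φ := fun ω => X (n + 1) ω - X n ω) (f := f)
    (hX.measurable_increment n).aemeasurable
    (by
      rw [hX.map_restrict_increment hT n hS]
      exact (integrable_finsetSum_measure.2 hi).1),
    hX.map_restrict_increment hT n hS, integral_finsetSum_measure hi]
  refine Finset.sum_congr rfl fun i _ => ?_
  rw [integral_smul_measure, ENNReal.toReal_ofReal (hc i), smul_eq_mul]

/-- The conditional expectation of a function of the increment given the past. -/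
theorem IsUrnChain.condExp_comp_increment (hX : U.IsUrnChain P X) (hT : U.IsTenable P X)
    (n : ℕ) {f : EuclideanSpace ℝ (Fin q) → ℝ} (hf : ∀ i, Integrable f (U.replacement i)) :
    P[fun ω => f (X (n + 1) ω - X n ω) | history X n] =ᵐ[P]
      fun ω => ∑ i, U.drawProb (X n ω) i * ∫ x, f x ∂(U.replacement i) := by
  have hi : ∀ i ∈ Finset.univ, Integrable
      (fun ω => U.drawProb (X n ω) i * ∫ x, f x ∂(U.replacement i)) P :=
    fun i _ => (hX.integrable_drawProb hT n i).mul_const _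
  symm
  refine ae_eq_condExp_of_forall_setIntegral_eq (hX.history_le n)
    (hX.integrable_comp_increment hT n hf)
    (fun S _ _ => (integrable_finsetSum _ hi).integrableOn) (fun S hS _ => ?_) ?_
  · rw [hX.setIntegral_comp_increment hT n hf hS,
      integral_finsetSum _ fun i h => (hi i h).integrableOn]
    simp only [integral_mul_const]
  · refine (Finset.measurable_sum _ fun i _ => ?_).stronglyMeasurable.aestronglyMeasurable
    exact ((measurable_drawProb i).comp (measurable_history le_rfl)).mul_const _

theorem IsUrnChain.totalActivity_eq (hX : U.IsUrnChain P X) (hT : U.IsTenable P X)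
    (hb : U.IsBalanced b) (n : ℕ) : ∀ᵐ ω ∂P, U.totalActivity (X n ω) = U.weight b n := by
  induction n with
  | zero => filter_upwards [hX.initial_eq] with ω hω; simp [hω, weight]
  | succ n ih =>
    filter_upwards [ih, hX.ae_increment hT n hb.2] with ω h1 h2
    rw [weight_succ, ← h1, ← h2, ← totalActivity_add, add_sub_cancel]

theorem IsUrnChain.totalActivity_initial_pos (hX : U.IsUrnChain P X) (hT : U.IsTenable P X) :
    0 < U.totalActivity U.initial := by
  obtain ⟨ω, h1, h2⟩ := (hX.initial_eq.and (hT 0)).exists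
  rw [← h1]; exact h2.2

end Chain

end PolyaUrn

/-! ### The martingale noise and the reduction to deterministic bounds -/

theorem eLpNorm_le_sum_eLpNorm_apply {q : ℕ} {Ω : Type*} [MeasurableSpace Ω] {P : Measure Ω}
    {p : ENNReal} (hp : 1 ≤ p) {V : Ω → EuclideanSpace ℝ (Fin q)}
    (hV : ∀ j, AEStronglyMeasurable (fun ω => V ω j) P) :
    eLpNorm V p P ≤ ∑ j, eLpNorm (fun ω => V ω j) p P := by
  have h1 : ∀ ω, ‖V ω‖ ≤ (∑ j, fun ω => ‖V ω j‖) ω := by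
    intro ω
    rw [Finset.sum_apply]
    conv_lhs => rw [← (EuclideanSpace.basisFun (Fin q) ℝ).sum_repr (V ω)]
    refine (norm_sum_le _ _).trans (Finset.sum_le_sum fun j _ => ?_)
    simp [norm_smul]
  refine (eLpNorm_mono_real h1).trans ((eLpNorm_sum_le (fun j _ => (hV j).norm) hp).trans ?_)
  simp only [eLpNorm_norm, le_refl]

namespace PolyaUrn

variable {q : ℕ} {U : PolyaUrn q} {b p : ℝ}

theorem memLp_replacement (hp : 2 ≤ p)
    (hmom : ∀ i j, Integrable (fun x : EuclideanSpace ℝ (Fin q) => |x j| ^ p) (U.replacement i))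
    (i j : Fin q) :
    MemLp (fun x : EuclideanSpace ℝ (Fin q) => x j) (ENNReal.ofReal p) (U.replacement i) :=
  (memLp_ofReal_iff_integrable hp (by fun_prop)).2 (hmom i j)

theorem one_le_ofReal_of_two_le (hp : 2 ≤ p) : 1 ≤ ENNReal.ofReal p := by
  rw [ENNReal.one_le_ofReal]; linarith

theorem integrable_replacement (hp : 2 ≤ p)
    (hmom : ∀ i j, Integrable (fun x : EuclideanSpace ℝ (Fin q) => |x j| ^ p) (U.replacement i))
    (i j : Fin q) :
    Integrable (fun x : EuclideanSpace ℝ (Fin q) => x j) (U.replacement i) :=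
  (memLp_replacement hp hmom i j).integrable (one_le_ofReal_of_two_le hp)

/-- A bound for the `L^p` norms of the increments of all urn processes with data `U`. -/
noncomputable def incrementBound (U : PolyaUrn q) (p : ℝ) : ℝ :=
  1 + ∑ i, ∑ j, ∫ x, |x j| ^ p ∂(U.replacement i)

theorem one_le_incrementBound (U : PolyaUrn q) (p : ℝ) : 1 ≤ U.incrementBound p :=
  le_add_of_nonneg_right (Finset.sum_nonneg fun _ _ => Finset.sum_nonneg fun _ _ =>
    integral_nonneg fun _ => Real.rpow_nonneg (abs_nonneg _) _)

/-- The martingale part of the increments of a balanced urn process. -/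
noncomputable def noise (U : PolyaUrn q) (b : ℝ) {Ω : Type*}
    (X : ℕ → Ω → EuclideanSpace ℝ (Fin q)) (n : ℕ) (ω : Ω) : Fin q → ℝ :=
  (X (n + 1) ω).ofLp - (X n ω).ofLp -
    (U.weight b n)⁻¹ • Matrix.toLin' U.intensity (X n ω).ofLp

theorem measurable_noise {Ω : Type*} {X : ℕ → Ω → EuclideanSpace ℝ (Fin q)} {n m : ℕ}
    (h : n < m) (j : Fin q) :
    Measurable[history X m] fun ω => U.noise b X n ω j := by
  have h1 : Measurable[history X m] (X (n + 1)) := measurable_history h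
  have h2 : Measurable[history X m] (X n) := measurable_history h.le
  simp only [noise, Pi.sub_apply, Pi.smul_apply, Matrix.toLin'_apply, Matrix.mulVec, dotProduct]
  fun_prop

section Chain

variable {Ω : Type*} [MeasurableSpace Ω] {P : Measure Ω} [IsProbabilityMeasure P]
  {X : ℕ → Ω → EuclideanSpace ℝ (Fin q)}

theorem IsUrnChain.memLp_increment (hX : U.IsUrnChain P X) (hT : U.IsTenable P X) (hp : 2 ≤ p)
    (hmom : ∀ i j, Integrable (fun x : EuclideanSpace ℝ (Fin q) => |x j| ^ p) (U.replacement i))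
    (n : ℕ) (j : Fin q) :
    MemLp (fun ω => (X (n + 1) ω - X n ω) j) (ENNReal.ofReal p) P := by
  have := hX.measurable_increment n
  have hj : Measurable fun x : EuclideanSpace ℝ (Fin q) => x j := by fun_prop
  refine (memLp_ofReal_iff_integrable hp (hj.comp this).aestronglyMeasurable).2 ?_
  exact hX.integrable_comp_increment hT n fun i => hmom i j

theorem IsUrnChain.eLpNorm_increment_le (hX : U.IsUrnChain P X) (hT : U.IsTenable P X)
    (hp : 2 ≤ p)
    (hmom : ∀ i j, Integrable (fun x : EuclideanSpace ℝ (Fin q) => |x j| ^ p) (U.replacement i))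
    (n : ℕ) (j : Fin q) :
    eLpNorm (fun ω => (X (n + 1) ω - X n ω) j) (ENNReal.ofReal p) P ≤
      ENNReal.ofReal (U.incrementBound p) := by
  have h1 := U.one_le_incrementBound p
  have h0 : ∀ i k, 0 ≤ ∫ x, |x k| ^ p ∂(U.replacement i) := fun i k =>
    integral_nonneg fun _ => Real.rpow_nonneg (abs_nonneg _) _
  rw [eLpNorm_le_ofReal_iff hp (by linarith) (hX.memLp_increment hT hp hmom n j)]
  have h2 := hX.setIntegral_comp_increment hT n (fun i => hmom i j) (S := Set.univ)
    MeasurableSet.univ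
  rw [setIntegral_univ] at h2
  rw [h2]
  calc _ ≤ ∑ i, 1 * ∫ x, |x j| ^ p ∂(U.replacement i) := by
        refine Finset.sum_le_sum fun i _ => mul_le_mul_of_nonneg_right ?_ (h0 i j)
        rw [setIntegral_univ]
        refine (integral_mono_ae (hX.integrable_drawProb hT n i) (integrable_const 1)
          ((hT n).mono fun ω hω => drawProb_le_one hω.1 hω.2 i)).trans (by simp)
    _ ≤ U.incrementBound p := by
        refine le_add_of_nonneg_of_le zero_le_one (Finset.sum_le_sum fun i _ => ?_)
        rw [one_mul]
        exact Finset.single_le_sum (f := fun j => ∫ x, |x j| ^ p ∂(U.replacement i))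
          (fun k _ => h0 i k) (Finset.mem_univ j)
    -- The summand 1 in `incrementBound` makes it at most its own p-th power, which avoids taking a
    -- root.
    _ ≤ _ := Real.self_le_rpow_of_one_le h1 (by linarith)

theorem IsUrnChain.memLp (hX : U.IsUrnChain P X) (hT : U.IsTenable P X) (hp : 2 ≤ p)
    (hmom : ∀ i j, Integrable (fun x : EuclideanSpace ℝ (Fin q) => |x j| ^ p) (U.replacement i))
    (n : ℕ) (j : Fin q) : MemLp (fun ω => X n ω j) (ENNReal.ofReal p) P := by
  induction n with
  | zero =>
    refine (memLp_congr_ae ?_).2 (memLp_const (U.initial j))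
    filter_upwards [hX.initial_eq] with ω hω
    rw [hω]
  | succ n ih =>
    convert ih.add (hX.memLp_increment hT hp hmom n j) using 1
    ext ω; simp

theorem IsUrnChain.integrable (hX : U.IsUrnChain P X) (hT : U.IsTenable P X) (hp : 2 ≤ p)
    (hmom : ∀ i j, Integrable (fun x : EuclideanSpace ℝ (Fin q) => |x j| ^ p) (U.replacement i))
    (n : ℕ) : Integrable (X n) P := by
  exact Integrable.of_eval_piLp fun j =>
    (hX.memLp hT hp hmom n j).integrable (one_le_ofReal_of_two_le hp)

/-- Balance makes the random normalisation of the draw probabilities equal to the deterministic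
weight, so the drift subtracted in `noise` is exactly the conditional mean. -/
theorem IsUrnChain.noise_ae_eq (hX : U.IsUrnChain P X) (hT : U.IsTenable P X)
    (hb : U.IsBalanced b) (hp : 2 ≤ p)
    (hmom : ∀ i j, Integrable (fun x : EuclideanSpace ℝ (Fin q) => |x j| ^ p) (U.replacement i))
    (n : ℕ) (j : Fin q) :
    (fun ω => U.noise b X n ω j) =ᵐ[P] (fun ω => (X (n + 1) ω - X n ω) j) -
      P[fun ω => (X (n + 1) ω - X n ω) j | history X n] := by
  filter_upwards [hX.totalActivity_eq hT hb n,
    hX.condExp_comp_increment hT n fun i => integrable_replacement hp hmom i j] with ω h1 h2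
  rw [Pi.sub_apply, h2, sum_drawProb_mul_integral, h1]
  simp [noise]

theorem IsUrnChain.memLp_noise (hX : U.IsUrnChain P X) (hT : U.IsTenable P X)
    (hb : U.IsBalanced b) (hp : 2 ≤ p)
    (hmom : ∀ i j, Integrable (fun x : EuclideanSpace ℝ (Fin q) => |x j| ^ p) (U.replacement i))
    (n : ℕ) (j : Fin q) : MemLp (fun ω => U.noise b X n ω j) (ENNReal.ofReal p) P :=
  have h := hX.memLp_increment hT hp hmom n j
  (memLp_congr_ae (hX.noise_ae_eq hT hb hp hmom n j)).2
    (h.sub (h.condExp (one_le_ofReal_of_two_le hp)))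

theorem IsUrnChain.eLpNorm_noise_le (hX : U.IsUrnChain P X) (hT : U.IsTenable P X)
    (hb : U.IsBalanced b) (hp : 2 ≤ p)
    (hmom : ∀ i j, Integrable (fun x : EuclideanSpace ℝ (Fin q) => |x j| ^ p) (U.replacement i))
    (n : ℕ) (j : Fin q) :
    eLpNorm (fun ω => U.noise b X n ω j) (ENNReal.ofReal p) P ≤
      ENNReal.ofReal (2 * U.incrementBound p) := by
  have h := hX.memLp_increment hT hp hmom n j
  have h1 := one_le_ofReal_of_two_le hp
  have h2 := hX.eLpNorm_increment_le hT hp hmom n j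
  have h3 := U.one_le_incrementBound p
  rw [eLpNorm_congr_ae (hX.noise_ae_eq hT hb hp hmom n j), two_mul,
    ENNReal.ofReal_add (by linarith) (by linarith)]
  exact (eLpNorm_sub_le h.1 (h.condExp h1).1 h1).trans
    (add_le_add h2 ((eLpNorm_condExp_le_eLpNorm _ h1).trans h2))

theorem IsUrnChain.condExp_noise (hX : U.IsUrnChain P X) (hT : U.IsTenable P X)
    (hb : U.IsBalanced b) (hp : 2 ≤ p)
    (hmom : ∀ i j, Integrable (fun x : EuclideanSpace ℝ (Fin q) => |x j| ^ p) (U.replacement i))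
    (n : ℕ) (j : Fin q) :
    P[fun ω => U.noise b X n ω j | history X n] =ᵐ[P] 0 := by
  have h := (hX.memLp_increment hT hp hmom n j).integrable (one_le_ofReal_of_two_le hp)
  refine (condExp_congr_ae (hX.noise_ae_eq hT hb hp hmom n j)).trans
    ((condExp_sub h integrable_condExp _).trans ?_)
  rw [condExp_of_stronglyMeasurable (hX.history_le n) stronglyMeasurable_condExp
    integrable_condExp, sub_self]

theorem IsUrnChain.integral_mul_noise (hX : U.IsUrnChain P X) (hT : U.IsTenable P X)
    (hb : U.IsBalanced b) (hp : 2 ≤ p)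
    (hmom : ∀ i j, Integrable (fun x : EuclideanSpace ℝ (Fin q) => |x j| ^ p) (U.replacement i))
    (n : ℕ) (j : Fin q) {g : Ω → ℝ} (hg : Measurable[history X n] g)
    (hgi : Integrable (g * fun ω => U.noise b X n ω j) P) :
    ∫ ω, g ω * U.noise b X n ω j ∂P = 0 := by
  have h1 := condExp_mul_of_stronglyMeasurable_left hg.stronglyMeasurable hgi
    ((hX.memLp_noise hT hb hp hmom n j).integrable (one_le_ofReal_of_two_le hp))
  change ∫ ω, (g * fun ω => U.noise b X n ω j) ω ∂P = 0
  rw [← integral_condExp (hX.history_le n), integral_congr_ae (g := 0)]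
  · simp
  · filter_upwards [h1, hX.condExp_noise hT hb hp hmom n j] with ω h2 h3
    rw [h2, Pi.mul_apply, h3, Pi.zero_apply, mul_zero]

/-- The activity of the increment is b, and so is that of the drift, by the left eigenvector
relation. -/
theorem IsUrnChain.sum_activity_mul_noise (hX : U.IsUrnChain P X) (hT : U.IsTenable P X)
    (hb : U.IsBalanced b) (hp : 2 ≤ p)
    (hmom : ∀ i j, Integrable (fun x : EuclideanSpace ℝ (Fin q) => |x j| ^ p) (U.replacement i))
    (n : ℕ) : ∀ᵐ ω ∂P, ∑ j, U.activity j * U.noise b X n ω j = 0 := by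
  filter_upwards [hX.totalActivity_eq hT hb n, hX.totalActivity_eq hT hb (n + 1), hT n]
    with ω h1 h2 h3
  have h4 : ∑ j, U.activity j * Matrix.toLin' U.intensity (X n ω).ofLp j
      = b * U.totalActivity (X n ω) := by
    simp only [Matrix.toLin'_apply, Matrix.mulVec, dotProduct, Finset.mul_sum]
    rw [Finset.sum_comm, totalActivity, Finset.mul_sum]
    refine Finset.sum_congr rfl fun k _ => ?_
    rw [← mul_assoc, ← hb.sum_activity_mul_intensity (integrable_replacement hp hmom),
      Finset.sum_mul]
    simp only [mul_assoc]
  have h5 : U.weight b n ≠ 0 := by rw [← h1]; exact h3.2.ne'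
  have h6 : ∑ j, U.activity j * U.noise b X n ω j = U.totalActivity (X (n + 1) ω) -
      U.totalActivity (X n ω) - (U.weight b n)⁻¹ *
        ∑ j, U.activity j * Matrix.toLin' U.intensity (X n ω).ofLp j := by
    simp only [noise, totalActivity, Finset.mul_sum, ← Finset.sum_sub_distrib]
    refine Finset.sum_congr rfl fun j _ => ?_
    simp only [Pi.sub_apply, Pi.smul_apply, smul_eq_mul]
    ring
  rw [h6, h4, h1, h2, weight_succ]
  field_simp
  ring

/-- The vector `e_j - a_j u`, where `u` is the initial state, scaled to total activity one. -/
noncomputable def kernelVec (U : PolyaUrn q) (j : Fin q) : Fin q → ℝ :=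
  Pi.single j 1 - (U.activity j * (U.totalActivity U.initial)⁻¹) • U.initial.ofLp

theorem sum_activity_mul_kernelVec (h : U.totalActivity U.initial ≠ 0) (j : Fin q) :
    ∑ i, U.activity i * U.kernelVec j i = 0 := by
  simp only [kernelVec, Pi.sub_apply, Pi.smul_apply, smul_eq_mul, mul_sub,
    Finset.sum_sub_distrib, Pi.single_apply, mul_ite, mul_one, mul_zero,
    Finset.sum_ite_eq', Finset.mem_univ, if_true]
  simp_rw [mul_left_comm (U.activity _) (U.activity j * _)]
  rw [← Finset.mul_sum, ← totalActivity]
  field_simp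
  ring

/-- This expands the random noise in finitely many fixed vectors of the kernel, so deterministic
bounds on those vectors suffice. The vectors need not be independent. -/
theorem eq_sum_smul_kernelVec {v : Fin q → ℝ} (h : ∑ j, U.activity j * v j = 0) :
    v = ∑ j, v j • U.kernelVec j := by
  simp only [kernelVec, smul_sub, Finset.sum_sub_distrib, smul_smul]
  rw [← Finset.sum_smul]
  have : ∑ j, v j * (U.activity j * (U.totalActivity U.initial)⁻¹) = 0 := by
    simp_rw [← mul_assoc, mul_comm (v _)]
    rw [← Finset.sum_mul, h, zero_mul]
  rw [this, zero_smul, sub_zero]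
  ext i
  simp [Finset.sum_apply, Pi.single_apply]

/-- The sums of squares of bounds for the propagators control the `L^p` distance of the urn to
its mean. -/
theorem IsUrnChain.eLpNorm_sub_integral_le (hX : U.IsUrnChain P X) (hT : U.IsTenable P X)
    (hb : U.IsBalanced b) (hp : 2 ≤ p)
    (hmom : ∀ i j, Integrable (fun x : EuclideanSpace ℝ (Fin q) => |x j| ^ p) (U.replacement i))
    {n : ℕ} (hn : 0 < n) {G : ℕ → ℝ} (hG : ∀ l < n, 0 < G l)
    (hFG : ∀ l < n, ∀ i j, |propagator (Matrix.toLin' U.intensity) (fun k => (U.weight b k)⁻¹)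
      (l + 1) n (U.kernelVec j) i| ≤ G l) :
    eLpNorm (fun ω => X n ω - ∫ ω', X n ω' ∂P) (ENNReal.ofReal p) P ≤
      ENNReal.ofReal (q * (√(8 * taylorConst p) * (2 * q * U.incrementBound p)) *
        √(∑ l ∈ Finset.range n, G l ^ 2)) := by
  have hp1 := one_le_ofReal_of_two_le hp
  have hD := U.one_le_incrementBound p
  have hC := one_le_taylorConst hp
  set c : ℕ → Fin q → Fin q → ℝ := fun l i j => propagator (Matrix.toLin' U.intensity)
    (fun k => (U.weight b k)⁻¹) (l + 1) n (U.kernelVec j) i with hc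
  -- The horizon n is fixed, so the weights c are deterministic and the partial sums over l of Z i l
  -- form a martingale.
  set Z : Fin q → ℕ → Ω → ℝ := fun i l ω => ∑ j, c l i j * U.noise b X l ω j with hZdef
  have hZm : ∀ i l, MemLp (Z i l) (ENNReal.ofReal p) P := fun i l =>
    memLp_finsetSum _ fun j _ => (hX.memLp_noise hT hb hp hmom l j).const_mul _
  have hZmeas : ∀ i l k, l < k → Measurable[history X k] (Z i l) := fun i l k hl =>
    Finset.measurable_sum _ fun j _ => (measurable_noise hl j).const_mul _
  have horth : ∀ i l (g : Ω → ℝ), Measurable[history X l] g →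
      (∀ j, Integrable (g * fun ω => U.noise b X l ω j) P) → ∫ ω, g ω * Z i l ω ∂P = 0 := by
    intro i l g hg hgi
    have : ∀ ω, g ω * Z i l ω = ∑ j, c l i j * (g ω * U.noise b X l ω j) := by
      intro ω
      rw [hZdef, Finset.mul_sum]
      exact Finset.sum_congr rfl fun j _ => by ring
    simp_rw [this]
    refine (integral_finsetSum _ fun j _ => (hgi j).const_mul _).trans ?_
    refine Finset.sum_eq_zero fun j _ => ?_
    refine (integral_const_mul _ _).trans ?_
    simp only [Pi.mul_apply]
    rw [hX.integral_mul_noise hT hb hp hmom l j hg (hgi j), mul_zero]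
  -- Variation of constants along each path: the first term is deterministic and will be the mean,
  -- since every Z i l is centred.
  have hrep : ∀ i, (fun ω => X n ω i) =ᵐ[P] fun ω =>
      propagator (Matrix.toLin' U.intensity) (fun k => (U.weight b k)⁻¹) 0 n U.initial.ofLp i +
        ∑ l ∈ Finset.range n, Z i l ω := by
    intro i
    filter_upwards [hX.initial_eq, ae_all_iff.2 fun l =>
      hX.sum_activity_mul_noise hT hb hp hmom l] with ω h0 hl
    have h1 := eq_propagator_add_sum (Matrix.toLin' U.intensity) (fun k => (U.weight b k)⁻¹)
      (fun n => (X n ω).ofLp) (fun n => U.noise b X n ω) (fun n => by simp [noise]) n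
    simp only [h0] at h1
    rw [h1, Pi.add_apply, Finset.sum_apply]
    congr 1
    refine Finset.sum_congr rfl fun l _ => ?_
    conv_lhs => rw [eq_sum_smul_kernelVec (hl l)]
    simp only [map_sum, map_smul, Finset.sum_apply, Pi.smul_apply, smul_eq_mul, hZdef, hc]
    exact Finset.sum_congr rfl fun j _ => mul_comm _ _
  have hmean : ∀ i l, ∫ ω, Z i l ω ∂P = 0 := by
    intro i l
    have := horth i l (fun _ => 1) measurable_const fun j => by
      change Integrable (1 * _) P
      rw [one_mul]; exact (hX.memLp_noise hT hb hp hmom l j).integrable hp1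
    simpa using this
  have hXi : ∀ i, (fun ω => (X n ω - ∫ ω', X n ω' ∂P) i) =ᵐ[P]
      fun ω => ∑ l ∈ Finset.range n, Z i l ω := by
    intro i
    have h1 : ∫ ω, X n ω i ∂P = propagator (Matrix.toLin' U.intensity)
        (fun k => (U.weight b k)⁻¹) 0 n U.initial.ofLp i := by
      rw [integral_congr_ae (hrep i), integral_add (integrable_const _)
        (integrable_finsetSum _ fun l _ => (hZm i l).integrable hp1),
        integral_finsetSum _ fun l _ => (hZm i l).integrable hp1]
      simp [hmean]
    filter_upwards [hrep i] with ω hω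
    rw [PiLp.sub_apply, eval_integral_piLp fun j => (hX.memLp hT hp hmom n j).integrable hp1,
      h1, hω, add_sub_cancel_left]
  set D := 2 * q * U.incrementBound p with hDdef
  have hcoord : ∀ i, eLpNorm (fun ω => (X n ω - ∫ ω', X n ω' ∂P) i) (ENNReal.ofReal p) P ≤
      ENNReal.ofReal (√(8 * taylorConst p) * D * √(∑ l ∈ Finset.range n, G l ^ 2)) := by
    intro i
    have hqpos : (0 : ℝ) < q := by exact_mod_cast i.pos
    have hDpos : 0 < D := by positivity
    rw [eLpNorm_congr_ae (hXi i)]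
    refine (eLpNorm_sum_le_sqrt_of_orthogonal hp (z := fun l => D * G l) hn
      (fun k _ => hZm i k) (fun k hk => mul_pos hDpos (hG k hk)) (fun k hk => ?_)
      (fun k hk => ?_)).trans (ENNReal.ofReal_le_ofReal (le_of_eq ?_))
    · have hZk : Z i k = ∑ j, c k i j • fun ω => U.noise b X k ω j := by
        ext ω; simp [hZdef]
      rw [hZk]
      refine (eLpNorm_sum_le (fun j _ =>
        ((hX.memLp_noise hT hb hp hmom k j).const_smul _).1) hp1).trans ?_
      calc _ ≤ ∑ _j : Fin q, ENNReal.ofReal (G k) * ENNReal.ofReal (2 * U.incrementBound p) := by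
            refine Finset.sum_le_sum fun j _ => ?_
            rw [eLpNorm_const_smul, Real.enorm_eq_ofReal_abs]
            exact mul_le_mul' (ENNReal.ofReal_le_ofReal (hFG k hk i j))
              (hX.eLpNorm_noise_le hT hb hp hmom k j)
        _ = ENNReal.ofReal (D * G k) := by
            rw [Finset.sum_const, Finset.card_univ, Fintype.card_fin, nsmul_eq_mul,
              ← ENNReal.ofReal_mul (hG k hk).le, ← ENNReal.ofReal_natCast,
              ← ENNReal.ofReal_mul (by positivity), hDdef]
            congr 1; ring
    · refine horth i k (fun ω => |∑ l ∈ Finset.range k, Z i l ω| ^ (p - 2) *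
        ∑ l ∈ Finset.range k, Z i l ω) ?_ fun j => ?_
      · have : Measurable[history X k] fun ω => ∑ l ∈ Finset.range k, Z i l ω :=
          Finset.measurable_sum _ fun l hl => hZmeas i l k (Finset.mem_range.1 hl)
        exact (by fun_prop : Measurable fun x : ℝ => |x| ^ (p - 2) * x).comp this
      · have hM : MemLp (fun ω => ∑ l ∈ Finset.range k, Z i l ω) (ENNReal.ofReal p) P :=
          memLp_finsetSum _ fun l _ => hZm i l
        have hY := hX.memLp_noise hT hb hp hmom k j
        have hMm := hM.1.aemeasurable
        have hYm := hY.1.aemeasurable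
        refine (((memLp_ofReal_iff_integrable hp hM.1).1 hM).add
          ((memLp_ofReal_iff_integrable hp hY.1).1 hY)).mono' ?_ (.of_forall fun ω => ?_)
        · exact (((hMm.abs.pow_const _).mul hMm).mul hYm).aestronglyMeasurable
        · exact abs_rpow_sub_two_mul_mul_le hp _ _
    · simp_rw [mul_pow]
      rw [← Finset.mul_sum, Real.sqrt_mul (by positivity) (D ^ 2 * _),
        Real.sqrt_mul (by positivity) (∑ l ∈ Finset.range n, G l ^ 2), Real.sqrt_sq hDpos.le,
        ← mul_assoc]
  refine (eLpNorm_le_sum_eLpNorm_apply hp1 fun j => ?_).trans ?_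
  · have := hX.measurable n
    exact Measurable.aestronglyMeasurable (by fun_prop)
  · refine (Finset.sum_le_sum fun i _ => hcoord i).trans (le_of_eq ?_)
    rw [Finset.sum_const, Finset.card_univ, Fintype.card_fin, nsmul_eq_mul,
      ← ENNReal.ofReal_natCast, ← ENNReal.ofReal_mul (by positivity)]
    congr 1; ring

/-- The linear bound for the `L^p` distance of the urn to its mean. -/
theorem IsUrnChain.eLpNorm_sub_integral_le_linear (hX : U.IsUrnChain P X) (hT : U.IsTenable P X)
    (hp : 2 ≤ p)
    (hmom : ∀ i j, Integrable (fun x : EuclideanSpace ℝ (Fin q) => |x j| ^ p) (U.replacement i))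
    (n : ℕ) :
    eLpNorm (fun ω => X n ω - ∫ ω', X n ω' ∂P) (ENNReal.ofReal p) P ≤
      ENNReal.ofReal (2 * q * U.incrementBound p * n) := by
  have hp1 := one_le_ofReal_of_two_le hp
  have hD := U.one_le_incrementBound p
  have h1 : ∀ i, eLpNorm (fun ω => X n ω i - U.initial i) (ENNReal.ofReal p) P ≤
      ENNReal.ofReal (n * U.incrementBound p) := by
    intro i
    have : (fun ω => X n ω i - U.initial i) =ᵐ[P]
        ∑ l ∈ Finset.range n, fun ω => (X (l + 1) ω - X l ω) i := by
      filter_upwards [hX.initial_eq] with ω hω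
      simp only [Finset.sum_apply, PiLp.sub_apply]
      rw [Finset.sum_range_sub (fun l => X l ω i), hω]
    rw [eLpNorm_congr_ae this]
    refine (eLpNorm_sum_le (fun l _ => (hX.memLp_increment hT hp hmom l i).1) hp1).trans
      ((Finset.sum_le_sum fun l _ => hX.eLpNorm_increment_le hT hp hmom l i).trans (le_of_eq ?_))
    rw [Finset.sum_const, Finset.card_range, nsmul_eq_mul, ← ENNReal.ofReal_natCast,
      ← ENNReal.ofReal_mul (by positivity)]
  have hi := fun i => (hX.memLp hT hp hmom n i).integrable hp1
  have hcoord : ∀ i, eLpNorm (fun ω => (X n ω - ∫ ω', X n ω' ∂P) i) (ENNReal.ofReal p) P ≤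
      ENNReal.ofReal (2 * (n * U.incrementBound p)) := by
    intro i
    have hm : MemLp (fun ω => X n ω i - U.initial i) (ENNReal.ofReal p) P :=
      (hX.memLp hT hp hmom n i).sub (memLp_const _)
    -- Viewing the mean as a conditional expectation given the trivial σ-field bounds it by L^p
    -- contractivity.
    have h2 : (fun ω => (X n ω - ∫ ω', X n ω' ∂P) i) = (fun ω => X n ω i - U.initial i) -
        P[fun ω => X n ω i - U.initial i | ⊥] := by
      ext ω
      rw [Pi.sub_apply, condExp_bot, integral_sub (hi i) (integrable_const _), PiLp.sub_apply,
        eval_integral_piLp hi]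
      simp
    rw [h2, two_mul, ENNReal.ofReal_add (by positivity) (by positivity)]
    exact (eLpNorm_sub_le hm.1 (hm.condExp hp1).1 hp1).trans
      (add_le_add (h1 i) ((eLpNorm_condExp_le_eLpNorm _ hp1).trans (h1 i)))
  refine (eLpNorm_le_sum_eLpNorm_apply hp1 fun j => ?_).trans ?_
  · have := hX.measurable n
    exact Measurable.aestronglyMeasurable (by fun_prop)
  · refine (Finset.sum_le_sum fun i _ => hcoord i).trans (le_of_eq ?_)
    rw [Finset.sum_const, Finset.card_univ, Fintype.card_fin, nsmul_eq_mul,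
      ← ENNReal.ofReal_natCast, ← ENNReal.ofReal_mul (by positivity)]
    congr 1; ring

end Chain

end PolyaUrn

/-! ### Sums over the weights a + k b -/

section ArithmeticProgression

open Finset

variable {a b : ℝ}

theorem add_natCast_mul_pos (ha : 0 < a) (hb : 0 < b) (k : ℕ) : 0 < a + k * b := by positivity

theorem summable_add_natCast_mul_rpow (ha : 0 < a) (hb : 0 < b) {s : ℝ} (hs : 1 < s) :
    Summable fun k : ℕ => ((a + k * b) ^ s)⁻¹ := by
  have h := ((Real.summable_one_div_nat_add_rpow (a / b) s).2 hs).mul_left (b ^ s)⁻¹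
  refine h.congr fun k => ?_
  have h1 : 0 < (k : ℝ) + a / b := by positivity
  rw [abs_of_pos h1, one_div, ← mul_inv, ← Real.mul_rpow hb.le h1.le]
  congr 2
  field_simp
  ring

theorem exists_sum_inv_sq_le (ha : 0 < a) (hb : 0 < b) :
    ∃ S : ℝ, 0 ≤ S ∧ ∀ i n : ℕ, ∑ k ∈ Ico i n, ((a + k * b)⁻¹) ^ 2 ≤ S := by
  have h := summable_add_natCast_mul_rpow ha hb (s := 2) (by norm_num)
  have h' : Summable fun k : ℕ => ((a + k * b)⁻¹) ^ 2 := h.congr fun k => by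
    rw [Real.rpow_two, inv_pow]
  exact ⟨_, tsum_nonneg fun _ => sq_nonneg _, fun i n =>
    h'.sum_le_tsum _ fun _ _ => sq_nonneg _⟩

/-- Consecutive weights have ratio 1 + x with x = b / (a + k b), and x - x² ≤ log (1 + x) ≤ x; the
logarithms telescope. -/
theorem abs_mul_sum_inv_sub_log_le (ha : 0 < a) (hb : 0 < b) {i n : ℕ} (h : i ≤ n) :
    |b * ∑ k ∈ Ico i n, (a + k * b)⁻¹ - Real.log ((a + n * b) / (a + i * b))| ≤
      b ^ 2 * ∑ k ∈ Ico i n, ((a + k * b)⁻¹) ^ 2 := by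
  induction n, h using Nat.le_induction with
  | base => simp [(add_natCast_mul_pos ha hb i).ne']
  | succ n h ih =>
    have hi := add_natCast_mul_pos ha hb i
    have hn := add_natCast_mul_pos ha hb n
    have hn' := add_natCast_mul_pos ha hb (n + 1)
    rw [sum_Ico_succ_top h, sum_Ico_succ_top h]
    set x := b * (a + n * b)⁻¹ with hx
    have hx0 : 0 < x := by positivity
    have e : (a + (n + 1 : ℕ) * b) / (a + i * b) = (a + n * b) / (a + i * b) * (1 + x) := by
      rw [hx]; push_cast; field_simp; ring
    rw [e, Real.log_mul (by positivity) (by positivity)]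
    have h1 : Real.log (1 + x) ≤ x := by
      have := Real.log_le_sub_one_of_pos (show 0 < 1 + x by positivity); linarith
    have h2 : x - x ^ 2 ≤ Real.log (1 + x) := by
      refine le_trans ?_ (Real.one_sub_inv_le_log_of_pos (show 0 < 1 + x by positivity))
      rw [le_sub_iff_add_le, ← le_sub_iff_add_le', inv_le_iff_one_le_mul₀ (by positivity)]
      nlinarith [pow_pos hx0 3]
    have h3 : b ^ 2 * ((a + n * b)⁻¹) ^ 2 = x ^ 2 := by rw [hx]; ring
    have h4 : b * (∑ k ∈ Ico i n, (a + k * b)⁻¹ + (a + n * b)⁻¹) =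
        b * ∑ k ∈ Ico i n, (a + k * b)⁻¹ + x := by rw [hx]; ring
    rw [h4, mul_add, h3]
    rw [abs_le] at ih ⊢
    constructor <;> nlinarith [ih.1, ih.2]

theorem exists_exp_mul_sum_inv_le (ha : 0 < a) (hb : 0 < b) (ρ : ℝ) :
    ∃ C : ℝ, 0 < C ∧ ∀ i n : ℕ, i ≤ n → Real.exp (ρ * ∑ k ∈ Ico i n, (a + k * b)⁻¹) ≤
      C * ((a + n * b) ^ (ρ / b) * ((a + i * b) ^ (ρ / b))⁻¹) := by
  obtain ⟨S, hS0, hS⟩ := exists_sum_inv_sq_le ha hb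
  refine ⟨Real.exp (|ρ / b| * (b ^ 2 * S)), Real.exp_pos _, fun i n h => ?_⟩
  have hi := add_natCast_mul_pos ha hb i
  have hn := add_natCast_mul_pos ha hb n
  rw [← div_eq_mul_inv, ← Real.div_rpow hn.le hi.le, Real.rpow_def_of_pos (by positivity),
    ← Real.exp_add]
  refine Real.exp_le_exp.2 ?_
  have h1 := (abs_mul_sum_inv_sub_log_le ha hb h).trans
    (mul_le_mul_of_nonneg_left (hS i n) (sq_nonneg b))
  set H := ∑ k ∈ Ico i n, (a + k * b)⁻¹
  set L := Real.log ((a + n * b) / (a + i * b))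
  have h2 : ρ * H = ρ / b * (b * H - L) + L * (ρ / b) := by field_simp; ring
  have h3 : ρ / b * (b * H - L) ≤ |ρ / b| * (b ^ 2 * S) := by
    refine (le_abs_self _).trans ?_
    rw [abs_mul]
    exact mul_le_mul_of_nonneg_left h1 (abs_nonneg _)
  linarith

theorem exists_one_add_sum_inv_le_log (ha : 0 < a) (hb : 0 < b) :
    ∃ C : ℝ, 0 < C ∧ ∀ n : ℕ, 2 ≤ n →
      1 + ∑ k ∈ Ico 0 n, (a + k * b)⁻¹ ≤ C * Real.log n := by
  obtain ⟨S, hS0, hS⟩ := exists_sum_inv_sq_le ha hb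
  have hl2 : 0 < Real.log 2 := Real.log_pos one_lt_two
  have hl : 0 ≤ Real.log (1 + b / a) := Real.log_nonneg (by
    have : 0 ≤ b / a := by positivity
    linarith)
  refine ⟨b⁻¹ + (1 + b⁻¹ * (Real.log (1 + b / a) + b ^ 2 * S)) / Real.log 2, by positivity,
    fun n hn => ?_⟩
  have hn1 : (1 : ℝ) ≤ n := by exact_mod_cast (by omega : 1 ≤ n)
  have hln : Real.log 2 ≤ Real.log n :=
    Real.log_le_log two_pos (by exact_mod_cast hn)
  have h1 := (abs_le.1 ((abs_mul_sum_inv_sub_log_le ha hb (Nat.zero_le n)).trans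
    (mul_le_mul_of_nonneg_left (hS 0 n) (sq_nonneg b)))).2
  have h2 : Real.log ((a + n * b) / (a + (0 : ℕ) * b)) ≤ Real.log n + Real.log (1 + b / a) := by
    rw [← Real.log_mul (by positivity) (by positivity)]
    refine Real.log_le_log (by positivity) ?_
    rw [Nat.cast_zero, zero_mul, add_zero, div_le_iff₀ ha]
    have : (n : ℝ) * (1 + b / a) * a = n * a + n * b := by field_simp
    nlinarith
  set H := ∑ k ∈ Ico 0 n, (a + k * b)⁻¹
  have h3 : H ≤ b⁻¹ * (Real.log n + Real.log (1 + b / a) + b ^ 2 * S) := by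
    rw [inv_mul_eq_div, le_div_iff₀ hb]; linarith
  have h4 : 1 + b⁻¹ * (Real.log (1 + b / a) + b ^ 2 * S) ≤
      (1 + b⁻¹ * (Real.log (1 + b / a) + b ^ 2 * S)) / Real.log 2 * Real.log n := by
    rw [div_mul_eq_mul_div, le_div_iff₀ hl2]
    exact mul_le_mul_of_nonneg_left hln (by positivity)
  linarith

theorem add_natCast_mul_le (ha : 0 < a) {n : ℕ} (hn : 1 ≤ n) : a + n * b ≤ (a + b) * n := by
  have hn1 : (1 : ℝ) ≤ n := by exact_mod_cast hn
  nlinarith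

theorem sum_inv_succ_le (ha : 0 < a) (hb : 0 < b) (n : ℕ) :
    ∑ l ∈ range n, (a + (l + 1 : ℕ) * b)⁻¹ ≤ ∑ k ∈ Ico 0 n, (a + k * b)⁻¹ := by
  rw [← range_eq_Ico]
  refine sum_le_sum fun l _ => ?_
  have := add_natCast_mul_pos ha hb l
  gcongr
  linarith

theorem sum_Ico_succ_inv_le (ha : 0 < a) (hb : 0 < b) (l n : ℕ) :
    ∑ k ∈ Ico (l + 1) n, (a + k * b)⁻¹ ≤ ∑ k ∈ Ico 0 n, (a + k * b)⁻¹ :=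
  sum_le_sum_of_subset_of_nonneg (Ico_subset_Ico_left (Nat.zero_le _)) fun k _ _ =>
    (inv_pos.2 (add_natCast_mul_pos ha hb k)).le

/-- Discrete comparison with the integral of w^(-θ): by Bernoulli's inequality for the exponent 1 -
θ ≤ 1, each step raises the right side by at least the new summand. -/
theorem sum_inv_rpow_le (ha : 0 < a) (hb : 0 < b) {θ : ℝ} (h0 : 0 ≤ θ) (h1 : θ < 1) (n : ℕ) :
    ∑ l ∈ range n, ((a + (l + 1 : ℕ) * b) ^ θ)⁻¹ ≤
      (b * (1 - θ))⁻¹ * (a + n * b) ^ (1 - θ) := by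
  have hθ : 0 < 1 - θ := by linarith
  induction n with
  | zero => simp; positivity
  | succ n ih =>
    have hn := add_natCast_mul_pos ha hb n
    have hn' := add_natCast_mul_pos ha hb (n + 1)
    rw [sum_range_succ]
    set w := a + (n + 1 : ℕ) * b with hw
    have e : a + n * b = w * (1 + -(b / w)) := by
      rw [mul_add, mul_neg, mul_div_cancel₀ _ hn'.ne', hw]; push_cast; ring
    have hbw : b / w ≤ 1 := by
      rw [div_le_one hn', hw]; push_cast; nlinarith [hn]
    have h2 := rpow_one_add_le_one_add_mul_self (s := -(b / w)) (by linarith) hθ.le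
      (by linarith : 1 - θ ≤ 1)
    have h3 : (a + n * b) ^ (1 - θ) ≤ w ^ (1 - θ) * (1 + (1 - θ) * -(b / w)) := by
      rw [e, Real.mul_rpow hn'.le (by linarith)]
      exact mul_le_mul_of_nonneg_left h2 (Real.rpow_nonneg hn'.le _)
    have h4 : w ^ (1 - θ) = w * (w ^ θ)⁻¹ := by
      rw [Real.rpow_sub hn', Real.rpow_one, div_eq_mul_inv]
    have h5 : (b * (1 - θ))⁻¹ * (w ^ (1 - θ) * (1 + (1 - θ) * -(b / w))) =
        (b * (1 - θ))⁻¹ * w ^ (1 - θ) - (w ^ θ)⁻¹ := by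
      rw [h4]; field_simp; ring
    have h6 := mul_le_mul_of_nonneg_left h3 (by positivity : 0 ≤ (b * (1 - θ))⁻¹)
    linarith

theorem exists_sum_sq_le_of_lt (ha : 0 < a) (hb : 0 < b) {ρ : ℝ} (hρ : ρ < b / 2) (ν : ℕ) :
    ∃ C : ℝ, 0 ≤ C ∧ ∀ n : ℕ, 2 ≤ n → ∑ l ∈ range n,
      (Real.exp (ρ * ∑ k ∈ Ico (l + 1) n, (a + k * b)⁻¹) *
        (1 + ∑ k ∈ Ico (l + 1) n, (a + k * b)⁻¹) ^ ν) ^ 2 ≤ (C * (n : ℝ) ^ (1 / 2 : ℝ)) ^ 2 := by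
  -- A rate σ strictly between ρ and b/2 absorbs the polynomial factor. It is also taken positive,
  -- so that θ = 2σ/b lies in [0, 1) and the sum of (w_n / w_{l+1})^θ is O(n).
  obtain ⟨σ, hσ1, hσ2⟩ := exists_between (max_lt hρ (by positivity : 0 < b / 2))
  obtain ⟨hσρ, hσ0⟩ := max_lt_iff.1 hσ1
  set θ := 2 * σ / b with hθ
  have hθ0 : 0 ≤ θ := by positivity
  have hθ1 : θ < 1 := by rw [hθ, div_lt_one hb]; linarith
  obtain ⟨D, hD, hD'⟩ := exists_one_add_pow_le_exp ν (sub_pos.2 hσρ)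
  obtain ⟨E, hE, hE'⟩ := exists_exp_mul_sum_inv_le ha hb (2 * σ)
  have hθ' : 0 < 1 - θ := by linarith
  refine ⟨√(D ^ 2 * E * (b * (1 - θ))⁻¹ * (a + b)), Real.sqrt_nonneg _, fun n hn => ?_⟩
  have hnw := add_natCast_mul_pos ha hb n
  have hterm : ∀ l ∈ range n, (Real.exp (ρ * ∑ k ∈ Ico (l + 1) n, (a + k * b)⁻¹) *
        (1 + ∑ k ∈ Ico (l + 1) n, (a + k * b)⁻¹) ^ ν) ^ 2 ≤
      D ^ 2 * E * (a + n * b) ^ θ * ((a + (l + 1 : ℕ) * b) ^ θ)⁻¹ := by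
    intro l hl
    have h1 := hE' (l + 1) n (mem_range.1 hl)
    have hH : 0 ≤ ∑ k ∈ Ico (l + 1) n, (a + k * b)⁻¹ :=
      sum_nonneg fun k _ => (inv_pos.2 (add_natCast_mul_pos ha hb k)).le
    set H := ∑ k ∈ Ico (l + 1) n, (a + k * b)⁻¹
    calc (Real.exp (ρ * H) * (1 + H) ^ ν) ^ 2
        ≤ (Real.exp (ρ * H) * (D * Real.exp ((σ - ρ) * H))) ^ 2 := by
          gcongr; exact hD' H hH
      _ = D ^ 2 * Real.exp (2 * σ * H) := by
          rw [mul_left_comm, ← Real.exp_add, mul_pow, ← Real.exp_nat_mul]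
          congr 2; push_cast; ring
      _ ≤ D ^ 2 * (E * ((a + n * b) ^ θ * ((a + (l + 1 : ℕ) * b) ^ θ)⁻¹)) := by gcongr
      _ = _ := by ring
  refine (sum_le_sum hterm).trans ?_
  rw [← mul_sum]
  have h2 := sum_inv_rpow_le ha hb hθ0 hθ1 n
  have h3 : (a + n * b) ^ θ * (a + n * b) ^ (1 - θ) = a + n * b := by
    rw [← Real.rpow_add hnw]; simp
  calc _ ≤ D ^ 2 * E * (a + n * b) ^ θ * ((b * (1 - θ))⁻¹ * (a + n * b) ^ (1 - θ)) := by gcongr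
    _ = D ^ 2 * E * (b * (1 - θ))⁻¹ * ((a + n * b) ^ θ * (a + n * b) ^ (1 - θ)) := by ring
    _ ≤ D ^ 2 * E * (b * (1 - θ))⁻¹ * ((a + b) * n) := by
        rw [h3]; gcongr; exact add_natCast_mul_le ha (by omega)
    _ = _ := by
        rw [mul_pow, Real.sq_sqrt (by positivity), ← Real.sqrt_eq_rpow,
          Real.sq_sqrt (by positivity)]
        ring

/-- In the critical case the squared exponentials are of order w_n / w_{l+1}, whose sum is of order
n log n. This harmonic sum supplies the one logarithm beyond the 2ν coming from the polynomial
factor. -/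
theorem exists_sum_sq_le_of_eq (ha : 0 < a) (hb : 0 < b) {ρ : ℝ} (hρ : ρ = b / 2) (ν : ℕ) :
    ∃ C : ℝ, 0 ≤ C ∧ ∀ n : ℕ, 2 ≤ n → ∑ l ∈ range n,
      (Real.exp (ρ * ∑ k ∈ Ico (l + 1) n, (a + k * b)⁻¹) *
        (1 + ∑ k ∈ Ico (l + 1) n, (a + k * b)⁻¹) ^ ν) ^ 2 ≤
      (C * (n : ℝ) ^ (1 / 2 : ℝ) * Real.log n ^ ((ν : ℝ) + 1 / 2)) ^ 2 := by
  obtain ⟨E, hE, hE'⟩ := exists_exp_mul_sum_inv_le ha hb b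
  obtain ⟨L, hL, hL'⟩ := exists_one_add_sum_inv_le_log ha hb
  refine ⟨√(E * (a + b) * L ^ (2 * ν + 1)), Real.sqrt_nonneg _, fun n hn => ?_⟩
  have hnw := add_natCast_mul_pos ha hb n
  have hlog : 0 < Real.log n := Real.log_pos (by exact_mod_cast (by omega : 1 < n))
  have hlog' := hL' n hn
  have hH0 : 0 ≤ ∑ k ∈ Ico 0 n, (a + k * b)⁻¹ :=
      sum_nonneg fun k _ => (inv_pos.2 (add_natCast_mul_pos ha hb k)).le
  have hterm : ∀ l ∈ range n, (Real.exp (ρ * ∑ k ∈ Ico (l + 1) n, (a + k * b)⁻¹) *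
        (1 + ∑ k ∈ Ico (l + 1) n, (a + k * b)⁻¹) ^ ν) ^ 2 ≤
      E * (a + n * b) * (L * Real.log n) ^ (2 * ν) * (a + (l + 1 : ℕ) * b)⁻¹ := by
    intro l hl
    have h1 := hE' (l + 1) n (mem_range.1 hl)
    rw [div_self hb.ne', Real.rpow_one, Real.rpow_one] at h1
    have hH : 0 ≤ ∑ k ∈ Ico (l + 1) n, (a + k * b)⁻¹ :=
      sum_nonneg fun k _ => (inv_pos.2 (add_natCast_mul_pos ha hb k)).le
    have h2 := sum_Ico_succ_inv_le ha hb l n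
    set H := ∑ k ∈ Ico (l + 1) n, (a + k * b)⁻¹
    calc (Real.exp (ρ * H) * (1 + H) ^ ν) ^ 2 = Real.exp (b * H) * (1 + H) ^ (2 * ν) := by
          rw [mul_pow, ← Real.exp_nat_mul, ← pow_mul, hρ, mul_comm ν]
          congr 2; push_cast; ring
      _ ≤ (E * ((a + n * b) * (a + (l + 1 : ℕ) * b)⁻¹)) * (L * Real.log n) ^ (2 * ν) := by
          gcongr; linarith
      _ = _ := by ring
  refine (sum_le_sum hterm).trans ?_
  rw [← mul_sum]
  have h3 := sum_inv_succ_le ha hb n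
  calc _ ≤ E * ((a + b) * n) * (L * Real.log n) ^ (2 * ν) * (L * Real.log n) := by
        have := add_natCast_mul_le (b := b) ha (show 1 ≤ n by omega)
        gcongr
        linarith
    _ = _ := by
        rw [mul_pow (√_ * _), mul_pow (√_), Real.sq_sqrt (by positivity), ← Real.sqrt_eq_rpow,
          Real.sq_sqrt (by positivity), ← Real.rpow_natCast (Real.log n ^ _),
          ← Real.rpow_mul hlog.le]
        have : ((ν : ℝ) + 1 / 2) * (2 : ℕ) = ((2 * ν + 1 : ℕ) : ℝ) := by push_cast; ring
        rw [this, Real.rpow_natCast]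
        ring

/-- Now the exponent s = 2ρ/b exceeds 1, the series of w_l^(-s) converges, and logarithms come only
from the polynomial factor. -/
theorem exists_sum_sq_le_of_gt (ha : 0 < a) (hb : 0 < b) {ρ : ℝ} (hρ : b / 2 < ρ) (ν : ℕ) :
    ∃ C : ℝ, 0 ≤ C ∧ ∀ n : ℕ, 2 ≤ n → ∑ l ∈ range n,
      (Real.exp (ρ * ∑ k ∈ Ico (l + 1) n, (a + k * b)⁻¹) *
        (1 + ∑ k ∈ Ico (l + 1) n, (a + k * b)⁻¹) ^ ν) ^ 2 ≤
      (C * (n : ℝ) ^ (ρ / b) * Real.log n ^ ν) ^ 2 := by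
  obtain ⟨E, hE, hE'⟩ := exists_exp_mul_sum_inv_le ha hb (2 * ρ)
  obtain ⟨L, hL, hL'⟩ := exists_one_add_sum_inv_le_log ha hb
  set s := 2 * ρ / b with hs
  have hs1 : 1 < s := by rw [hs, lt_div_iff₀ hb]; linarith
  have hsum := summable_add_natCast_mul_rpow ha hb hs1
  have hpos : ∀ k : ℕ, 0 ≤ ((a + k * b) ^ s)⁻¹ := fun k =>
    inv_nonneg.2 (Real.rpow_nonneg (add_natCast_mul_pos ha hb k).le _)
  set T := ∑' k : ℕ, ((a + k * b) ^ s)⁻¹ with hT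
  have hT0 : 0 ≤ T := tsum_nonneg hpos
  refine ⟨√(E * (a + b) ^ s * L ^ (2 * ν) * T), Real.sqrt_nonneg _, fun n hn => ?_⟩
  have hnw := add_natCast_mul_pos ha hb n
  have hlog : 0 < Real.log n := Real.log_pos (by exact_mod_cast (by omega : 1 < n))
  have hlog' := hL' n hn
  have hterm : ∀ l ∈ range n, (Real.exp (ρ * ∑ k ∈ Ico (l + 1) n, (a + k * b)⁻¹) *
        (1 + ∑ k ∈ Ico (l + 1) n, (a + k * b)⁻¹) ^ ν) ^ 2 ≤
      E * (a + n * b) ^ s * (L * Real.log n) ^ (2 * ν) * ((a + (l + 1 : ℕ) * b) ^ s)⁻¹ := by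
    intro l hl
    have h1 := hE' (l + 1) n (mem_range.1 hl)
    have hH : 0 ≤ ∑ k ∈ Ico (l + 1) n, (a + k * b)⁻¹ :=
      sum_nonneg fun k _ => (inv_pos.2 (add_natCast_mul_pos ha hb k)).le
    have h2 := sum_Ico_succ_inv_le ha hb l n
    set H := ∑ k ∈ Ico (l + 1) n, (a + k * b)⁻¹
    calc (Real.exp (ρ * H) * (1 + H) ^ ν) ^ 2 = Real.exp (2 * ρ * H) * (1 + H) ^ (2 * ν) := by
          rw [mul_pow, ← Real.exp_nat_mul, ← pow_mul, mul_comm ν]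
          congr 2; push_cast; ring
      _ ≤ (E * ((a + n * b) ^ s * ((a + (l + 1 : ℕ) * b) ^ s)⁻¹)) *
            (L * Real.log n) ^ (2 * ν) := by
          gcongr; linarith
      _ = _ := by ring
  refine (sum_le_sum hterm).trans ?_
  rw [← mul_sum]
  have h3 : ∑ l ∈ range n, ((a + (l + 1 : ℕ) * b) ^ s)⁻¹ ≤ T := by
    refine le_trans ?_ (hsum.sum_le_tsum (range (n + 1)) fun k _ => hpos k)
    rw [sum_range_succ' (fun k : ℕ => ((a + k * b) ^ s)⁻¹)]
    exact le_add_of_nonneg_right (hpos 0)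
  calc _ ≤ E * ((a + b) * n) ^ s * (L * Real.log n) ^ (2 * ν) * T := by
        have := add_natCast_mul_le (b := b) ha (show 1 ≤ n by omega)
        gcongr
    _ = _ := by
        rw [mul_pow (√_ * _), mul_pow (√_), Real.sq_sqrt (by positivity), Real.mul_rpow (by positivity)
          (by positivity), ← Real.rpow_natCast ((n : ℝ) ^ _), ← Real.rpow_mul (by positivity)]
        have : ρ / b * (2 : ℕ) = s := by rw [hs]; push_cast; ring
        rw [this]
        ring

end ArithmeticProgression

/-! ### Combining the spectral and probabilistic bounds -/

namespace PolyaUrn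

variable {q : ℕ} {U : PolyaUrn q} {b p : ℝ}

open Finset in
theorem exists_abs_propagator_kernelVec_le (hq0 : 0 < q) (hq1 : 1 < q) (hbal : U.IsBalanced b)
    (hint : ∀ i j, Integrable (fun x : EuclideanSpace ℝ (Fin q) => x j) (U.replacement i))
    (hw : 0 < U.totalActivity U.initial)
    {ev : Fin q → ℂ} (hev : IsEigenvalueOrdering U.intensityC ev)
    (hev1 : ev ⟨0, hq0⟩ = (b : ℂ)) (hlt : (ev ⟨1, hq1⟩).re < b) :
    ∃ K : ℝ, 0 < K ∧ ∀ i n, i ≤ n → ∀ r j,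
      |propagator (Matrix.toLin' U.intensity) (fun k => (U.weight b k)⁻¹) i n
        (U.kernelVec j) r| ≤
      K * (Real.exp ((ev ⟨1, hq1⟩).re * ∑ k ∈ Ico i n, (U.weight b k)⁻¹) *
        (1 + ∑ k ∈ Ico i n, (U.weight b k)⁻¹) ^
          jordanIndex U.intensityC (ev ⟨1, hq1⟩)) := by
  set φ : (Fin q → ℂ) →ₗ[ℂ] ℂ := ∑ j, (U.activity j : ℂ) • LinearMap.proj j with hφdef
  have hφ_apply : ∀ v, φ v = ∑ j, (U.activity j : ℂ) * v j := by
    intro v; simp [hφdef, LinearMap.sum_apply]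
  have hφ_real : ∀ v : Fin q → ℝ,
      φ (fun j => (v j : ℂ)) = ((∑ j, U.activity j * v j : ℝ) : ℂ) := by
    intro v; rw [hφ_apply]; push_cast; rfl
  have hφ : φ ≠ 0 := by
    intro h0
    have := hφ_real U.initial.ofLp
    rw [h0, LinearMap.zero_apply, eq_comm, Complex.ofReal_eq_zero] at this
    exact hw.ne' this
  have hφA : φ ∘ₗ Matrix.toLin' U.intensityC = ev ⟨0, hq0⟩ • φ := by
    refine LinearMap.ext fun v => ?_
    rw [LinearMap.comp_apply, LinearMap.smul_apply, hφ_apply, hφ_apply, hev1, smul_eq_mul]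
    simp only [Matrix.toLin'_apply, Matrix.mulVec, dotProduct, Finset.mul_sum]
    rw [Finset.sum_comm]
    refine Finset.sum_congr rfl fun k _ => ?_
    have := congrArg (fun x : ℝ => (x : ℂ)) (hbal.sum_activity_mul_intensity hint k)
    simp only [Complex.ofReal_sum, Complex.ofReal_mul] at this
    rw [← mul_assoc, ← this, Finset.sum_mul]
    refine Finset.sum_congr rfl fun i _ => ?_
    simp [intensityC, mul_assoc]
  have hτ : ∀ k, 0 < U.weight b k := fun k => add_natCast_mul_pos hw hbal.1 k
  obtain ⟨S, -, hS⟩ := exists_sum_inv_sq_le hw hbal.1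
  have hker := hev.ker_le_growthSubmodule hq0 hq1 (by rw [hev1]; exact hlt) φ hφ hφA
    (τ := fun k => (U.weight b k)⁻¹) (T := (U.weight b 0)⁻¹) (S := S)
    (fun k => (inv_pos.2 (hτ k)).le)
    (fun k => inv_anti₀ (hτ 0) (by
      simp only [weight, Nat.cast_zero, zero_mul, add_zero]
      have := hbal.1
      exact le_add_of_nonneg_right (by positivity))) hS
  have hmem : ∀ j, (fun r => (U.kernelVec j r : ℂ)) ∈ LinearMap.ker φ := fun j => by
    rw [LinearMap.mem_ker, hφ_real, sum_activity_mul_kernelVec hw.ne', Complex.ofReal_zero]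
  choose C hC hCb using fun j => hker (hmem j)
  -- The summand 1 makes the constant strictly positive, as the moment inequality requires positive
  -- bounds.
  refine ⟨1 + ∑ j, C j, add_pos_of_pos_of_nonneg one_pos (Finset.sum_nonneg fun j _ => hC j),
    fun i n hin r j => ?_⟩
  have hH : 0 ≤ ∑ k ∈ Ico i n, (U.weight b k)⁻¹ :=
    Finset.sum_nonneg fun k _ => (inv_pos.2 (hτ k)).le
  have h1 := hCb j i n hin
  rw [intensityC, ofReal_propagator_mulVec] at h1
  have h2 := (norm_le_pi_norm _ r).trans h1
  rw [Complex.norm_real, Real.norm_eq_abs] at h2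
  refine h2.trans (mul_le_mul_of_nonneg_right ?_ (by positivity))
  have := Finset.single_le_sum (fun j _ => hC j) (Finset.mem_univ j)
  linarith

open Finset in
/-- Square summable bounds for the propagators yield, with a constant that depends on the urn
data only, bounds for the `L^p` distance of the urn to its mean. -/
theorem exists_eLpNorm_sub_integral_le (hq0 : 0 < q) (hq1 : 1 < q) (hbal : U.IsBalanced b) (hp : 2 ≤ p)
    (hmom : ∀ i j, Integrable (fun x : EuclideanSpace ℝ (Fin q) => |x j| ^ p) (U.replacement i))
    (hw : 0 < U.totalActivity U.initial)
    {ev : Fin q → ℂ} (hev : IsEigenvalueOrdering U.intensityC ev)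
    (hev1 : ev ⟨0, hq0⟩ = (b : ℂ)) (hlt : (ev ⟨1, hq1⟩).re < b)
    {B : ℕ → ℝ} (hB0 : ∀ n, 2 ≤ n → 0 ≤ B n)
    (hB : ∀ n, 2 ≤ n → ∑ l ∈ range n,
      (Real.exp ((ev ⟨1, hq1⟩).re * ∑ k ∈ Ico (l + 1) n, (U.weight b k)⁻¹) *
        (1 + ∑ k ∈ Ico (l + 1) n, (U.weight b k)⁻¹) ^
          jordanIndex U.intensityC (ev ⟨1, hq1⟩)) ^ 2 ≤ B n ^ 2) :
    ∃ C : ℝ, 0 ≤ C ∧ ∀ {Ω : Type*} [MeasurableSpace Ω] (P : Measure Ω) [IsProbabilityMeasure P]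
      (X : ℕ → Ω → EuclideanSpace ℝ (Fin q)), U.IsUrnChain P X → U.IsTenable P X →
      ∀ n, 2 ≤ n → eLpNorm (fun ω => X n ω - ∫ ω', X n ω' ∂P) (ENNReal.ofReal p) P ≤
        ENNReal.ofReal (C * B n) := by
  obtain ⟨K, hK, hKb⟩ := exists_abs_propagator_kernelVec_le hq0 hq1 hbal
    (integrable_replacement hp hmom) hw hev hev1 hlt
  have hD := U.one_le_incrementBound p
  refine ⟨q * (√(8 * taylorConst p) * (2 * q * U.incrementBound p)) * K, by positivity, ?_⟩
  intro Ω _ P _ X hX hT n hn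
  have hH : ∀ l, 0 ≤ ∑ k ∈ Ico (l + 1) n, (U.weight b k)⁻¹ := fun l =>
    Finset.sum_nonneg fun k _ => (inv_pos.2 (add_natCast_mul_pos hw hbal.1 k)).le
  refine (hX.eLpNorm_sub_integral_le hT hbal hp hmom (by omega)
    (fun l _ => ?_) fun l hl => hKb (l + 1) n hl).trans (ENNReal.ofReal_le_ofReal ?_)
  · have := hH l
    positivity
  · rw [mul_assoc _ K]
    refine mul_le_mul_of_nonneg_left ?_ (by positivity)
    rw [Real.sqrt_le_left (mul_nonneg hK.le (hB0 n hn)), mul_pow]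
    simp_rw [mul_pow K]
    rw [← Finset.mul_sum]
    exact mul_le_mul_of_nonneg_left (hB n hn) (sq_nonneg K)

end PolyaUrn

theorem theorem3p1 {q : ℕ} (hq : 2 ≤ q) (U : PolyaUrn q) (b : ℝ) (hbal : U.IsBalanced b)
    (ev : Fin q → ℂ) (hev : IsEigenvalueOrdering U.intensityC ev)
    (hev1 : ev ⟨0, by omega⟩ = (b : ℂ))
    (p : ℝ) (hp : 2 ≤ p)
    (hmom : ∀ i j, Integrable (fun x : EuclideanSpace ℝ (Fin q) => |x j| ^ p)
      (U.replacement i)) :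
    ∃ C : ℝ, ∀ {Ω : Type*} [MeasurableSpace Ω] (P : Measure Ω) [IsProbabilityMeasure P]
      (X : ℕ → Ω → EuclideanSpace ℝ (Fin q)),
      U.IsUrnChain P X → U.IsTenable P X →
      ∀ n : ℕ, 2 ≤ n →
        Integrable (X n) P ∧
        ((ev ⟨1, by omega⟩).re < b / 2 →
          eLpNorm (fun ω => X n ω - ∫ ω', X n ω' ∂P) (ENNReal.ofReal p) P
            ≤ ENNReal.ofReal (C * (n : ℝ) ^ (1 / 2 : ℝ))) ∧
        ((ev ⟨1, by omega⟩).re = b / 2 →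
          eLpNorm (fun ω => X n ω - ∫ ω', X n ω' ∂P) (ENNReal.ofReal p) P
            ≤ ENNReal.ofReal (C * (n : ℝ) ^ (1 / 2 : ℝ) *
              Real.log n ^ ((jordanIndex U.intensityC (ev ⟨1, by omega⟩) : ℝ) + 1 / 2))) ∧
        (b / 2 < (ev ⟨1, by omega⟩).re →
          eLpNorm (fun ω => X n ω - ∫ ω', X n ω' ∂P) (ENNReal.ofReal p) P
            ≤ ENNReal.ofReal (C * (n : ℝ) ^ ((ev ⟨1, by omega⟩).re / b) *
              Real.log n ^ jordanIndex U.intensityC (ev ⟨1, by omega⟩))) := by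
  -- The constant is chosen before the process. Without positive initial activity there is no
  -- tenable process, so any constant will do.
  by_cases hw : 0 < U.totalActivity U.initial
  swap
  · exact ⟨0, fun P _ X hX hT => absurd (hX.totalActivity_initial_pos hT) hw⟩
  have hb := hbal.1
  have hlog : ∀ n : ℕ, 2 ≤ n → 0 ≤ Real.log n := fun n hn =>
    Real.log_nonneg (by exact_mod_cast (by omega : 1 ≤ n))
  rcases lt_or_ge (ev ⟨1, by omega⟩).re b with hlt | hge
  · rcases lt_trichotomy (ev ⟨1, by omega⟩).re (b / 2) with h | h | h
    · obtain ⟨D, hD, hDb⟩ := exists_sum_sq_le_of_lt hw hb h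
        (jordanIndex U.intensityC (ev ⟨1, by omega⟩))
      obtain ⟨C, -, hC⟩ := PolyaUrn.exists_eLpNorm_sub_integral_le (by omega) (by omega) hbal hp hmom hw hev hev1
        hlt (fun n _ => by positivity) hDb
      refine ⟨C * D, fun P _ X hX hT n hn => ⟨hX.integrable hT hp hmom n,
        fun _ => (hC P X hX hT n hn).trans_eq (by ring_nf),
        fun h' => absurd h' h.ne, fun h' => absurd h' h.le.not_gt⟩⟩
    · obtain ⟨D, hD, hDb⟩ := exists_sum_sq_le_of_eq hw hb h
        (jordanIndex U.intensityC (ev ⟨1, by omega⟩))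
      obtain ⟨C, -, hC⟩ := PolyaUrn.exists_eLpNorm_sub_integral_le (by omega) (by omega) hbal hp hmom hw hev hev1
        hlt (fun n hn => by have := hlog n hn; positivity) hDb
      refine ⟨C * D, fun P _ X hX hT n hn => ⟨hX.integrable hT hp hmom n,
        fun h' => absurd h' h.ge.not_gt,
        fun _ => (hC P X hX hT n hn).trans_eq (by simp only [mul_assoc]),
        fun h' => absurd h' h.le.not_gt⟩⟩
    · obtain ⟨D, hD, hDb⟩ := exists_sum_sq_le_of_gt hw hb h
        (jordanIndex U.intensityC (ev ⟨1, by omega⟩))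
      obtain ⟨C, -, hC⟩ := PolyaUrn.exists_eLpNorm_sub_integral_le (by omega) (by omega) hbal hp hmom hw hev hev1
        hlt (fun n hn => by have := hlog n hn; positivity) hDb
      refine ⟨C * D, fun P _ X hX hT n hn => ⟨hX.integrable hT hp hmom n,
        fun h' => absurd h' h.le.not_gt, fun h' => absurd h' h.ne',
        fun _ => (hC P X hX hT n hn).trans_eq (by simp only [mul_assoc])⟩⟩
  -- Here b may be a multiple eigenvalue and the kernel argument is unavailable, but the rate to
  -- prove is n (log n)^ν.
  · have hre : (ev ⟨1, by omega⟩).re = b := by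
      refine le_antisymm ?_ hge
      have := hev.re_antitone ⟨0, by omega⟩ ⟨1, by omega⟩ (by simp [Fin.le_def])
      rwa [hev1, Complex.ofReal_re] at this
    set ν := jordanIndex U.intensityC (ev ⟨1, by omega⟩)
    have hl2 : 0 < Real.log 2 := Real.log_pos one_lt_two
    have hD := U.one_le_incrementBound p
    -- Dividing by (log 2)^ν makes the linear bound fit under n (log n)^ν for all n ≥ 2.
    refine ⟨2 * q * U.incrementBound p / Real.log 2 ^ ν, fun P _ X hX hT n hn =>
      ⟨hX.integrable hT hp hmom n, fun h' => by linarith, fun h' => by linarith,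
        fun _ => (hX.eLpNorm_sub_integral_le_linear hT hp hmom n).trans
          (ENNReal.ofReal_le_ofReal ?_)⟩⟩
    rw [hre, div_self hb.ne', Real.rpow_one]
    have h1 : Real.log 2 ^ ν ≤ Real.log n ^ ν := by
      gcongr
      exact_mod_cast hn
    calc 2 * q * U.incrementBound p * n
        = 2 * q * U.incrementBound p / Real.log 2 ^ ν * n * Real.log 2 ^ ν := by field_simp
      _ ≤ _ := by gcongr
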